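/- Let $G$ be a second countable (for instance connected) real Lie group with Lie algebra $\mathfrak g$, acting smoothly and transitively on a smooth (finite-dimensional, Hausdorff) manifold $\mathcal X$. Let $p_0\in\mathcal X$ and $K=\mathrm{Stab}_G(p_0)$, so that $\mathcal X$ is a model of $G/K$. Let $\mathfrak k=\mathrm{Lie}(K)$ and let $\mathfrak g=\mathfrak k\oplus\mathfrak m$ be a Cartan decomposition: there is an $\mathrm{Ad}(G)$-invariant symmetric bilinear form on $\mathfrak g$ that is negative definite on $\mathfrak k$, positive definite on $\mathfrak m$, and for which $\mathfrak k\perp\mathfrak m$. Let $X$ be a connected smooth manifold (for instance a compact Riemann surface of genus at least $2$) with universal covering $\tilde X\to X$, on which $\pi_1(X)$ acts by deck transformations, let $\rho\colon\pi_1(X)\to G$ be a homomorphism, and let $f\colon\tilde X\to\mathcal X$ be a smooth $\rho$-equivariant map. Pulled back to $\tilde X$, the flat principal $G$-bundle $E_G$ of $\rho$ is $\tilde X\times G$, where $c\in\pi_1(X)$ acts by $(x,g)\mapsto(cx,\rho(c)g)$ and the connection form of $\nabla$ is the Maurer--Cartan form $\omega^{MC}$ of $G$. The reduction to $K$ given by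 $f$ is $E_K=f^*G=\{(x,g)\mid g\,p_0=f(x)\}$. The associated bundle is $E_K(\mathfrak m)=f^*(G\times_K\mathfrak m)$, whose elements over $x$ are the classes $[g,v]$ with $g\,p_0=f(x)$, $v\in\mathfrak m$ and $[gk,\mathrm{Ad}(k^{-1})v]=[g,v]$ for $k\in K$; the group $\pi_1(X)$ acts on it by $c\,[g,v]=[\rho(c)g,v]$, and on $f^*T\mathcal X$ by the differentials of the maps $y\mapsto\rho(c)y$. Then: 1. $G\times_K\mathfrak m$, with the quotient topology, is a smooth real vector bundle over $\mathcal X$ such that the quotient map $G\times\mathfrak m\to G\times_K\mathfrak m$ is a smooth submersion; hence $E_K(\mathfrak m)$ is a smooth real vector bundle over $\tilde X$. 2. On $E_K$ one has $\nabla=D+\Psi$, where $D$, the $\mathfrak k$-part of $\nabla$, is a $\pi_1(X)$-invariant principal $K$-connection on $E_K$. The $\mathfrak m$-part $\Psi$ of $\nabla$ corresponds to a smooth $\pi_1(X)$-equivariant one-form on $\tilde X$ with values in $E_K(\mathfrak m)$, again denoted $\Psi$. It is the unique one with $\Psi_x(u)=[g,\mathrm{pr}_{\mathfrak m}\,\omega^{MC}_g(w)]$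 for every $(x,g)\in E_K$ and every tangent vector $(u,w)$ of $E_K$ at $(x,g)$. 3. There is an isomorphism of smooth real vector bundles over $\tilde X$ $$\Phi\colon E_K(\mathfrak m)\xrightarrow{\ \cong\ }f^*T\mathcal X,\qquad [g,v]\mapsto\left.\tfrac{d}{dt}\right|_{t=0}g\exp(tv)\,p_0,$$ which is equivariant under the action of $\pi_1(X)$. 4. Under this identification $\Psi=df$, that is, $\Phi(\Psi_x(u))=df_x(u)$ for all $x\in\tilde X$ and $u\in T_x\tilde X$. -/

import Mathlib

open Bundle
open scoped Manifold ContDiff Bundle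

namespace SymBundle

noncomputable section

/-! ### Lie groups

All manifolds are modelled on real normed spaces.  For a Lie group `G` modelled on `EG`, the Lie
algebra `𝔤 = T₁G` is, as a vector space, definitionally `EG`; we write it `EG` throughout. -/

section LieGroup

variable {EG : Type*} [NormedAddCommGroup EG] [NormedSpace ℝ EG]
  {G : Type*} [TopologicalSpace G] [ChartedSpace EG G] [Group G]

/-- `γ` is a smooth curve with `γ 0 = p` and velocity `v` at time `0`. -/
def IsCurveWithVelocity {E : Type*} [NormedAddCommGroup E] [NormedSpace ℝ E]
    {N : Type*} [TopologicalSpace N] [ChartedSpace E N]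
    (γ : ℝ → N) (p : N) (v : TangentSpace 𝓘(ℝ, E) p) : Prop :=
  ContMDiff 𝓘(ℝ) 𝓘(ℝ, E) ∞ γ ∧ γ 0 = p ∧ (mfderiv 𝓘(ℝ) 𝓘(ℝ, E) γ 0 (1 : ℝ) : E) = v

variable (EG) in
/-- The adjoint action of `g` on `𝔤`: the differential at `1` of `h ↦ g h g⁻¹`. -/
def Ad (g : G) : EG →L[ℝ] EG :=
  mfderiv 𝓘(ℝ, EG) 𝓘(ℝ, EG) (fun h : G => g * h * g⁻¹) 1

/-- The Maurer--Cartan form: at `g` it is the differential of left translation by `g⁻¹`. -/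
def maurerCartan (g : G) : TangentSpace 𝓘(ℝ, EG) g →L[ℝ] EG :=
  mfderiv 𝓘(ℝ, EG) 𝓘(ℝ, EG) (fun h : G => g⁻¹ * h) g

section helpers

variable [LieGroup 𝓘(ℝ, EG) ∞ G]

lemma mdifferentiable_mul_left (g : G) :
    MDifferentiable 𝓘(ℝ, EG) 𝓘(ℝ, EG) (fun h : G => g * h) :=
  (contMDiff_mul_left (I := 𝓘(ℝ, EG)) (n := ∞) (a := g)).mdifferentiable (by simp)

lemma contMDiff_conj (g : G) :
    ContMDiff 𝓘(ℝ, EG) 𝓘(ℝ, EG) ∞ (fun h : G => g * h * g⁻¹) :=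
  (contMDiff_const.mul contMDiff_id).mul contMDiff_const

lemma mdifferentiable_conj (g : G) :
    MDifferentiable 𝓘(ℝ, EG) 𝓘(ℝ, EG) (fun h : G => g * h * g⁻¹) :=
  (contMDiff_conj g).mdifferentiable (by simp)

lemma hasMFDerivAt_conj (g p : G) (hp : p = 1) :
    HasMFDerivAt 𝓘(ℝ, EG) 𝓘(ℝ, EG) (fun h : G => g * h * g⁻¹) p (Ad EG g) := by
  subst hp
  exact (mdifferentiable_conj g 1).hasMFDerivAt

lemma hasMFDerivAt_mul_one (p : G × G) (hp : p = (1, 1)) :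
    HasMFDerivAt (𝓘(ℝ, EG).prod 𝓘(ℝ, EG)) 𝓘(ℝ, EG) (fun q : G × G => q.1 * q.2) p
      (ContinuousLinearMap.fst ℝ EG EG + ContinuousLinearMap.snd ℝ EG EG : EG × EG →L[ℝ] EG) := by
  subst hp
  have hd : MDifferentiableAt (𝓘(ℝ, EG).prod 𝓘(ℝ, EG)) 𝓘(ℝ, EG)
      (fun q : G × G => q.1 * q.2) (1, 1) :=
    ((contMDiff_mul 𝓘(ℝ, EG) ∞).mdifferentiable (by simp)) _
  have h := hd.hasMFDerivAt
  have e : mfderiv (𝓘(ℝ, EG).prod 𝓘(ℝ, EG)) 𝓘(ℝ, EG) (fun q : G × G => q.1 * q.2) (1, 1)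
      = (ContinuousLinearMap.fst ℝ EG EG + ContinuousLinearMap.snd ℝ EG EG :
          EG × EG →L[ℝ] EG) := by
    have e1 : (fun z : G => z * 1) = id := by ext; simp
    have e2 : (fun z : G => 1 * z) = id := by ext; simp
    have a1 : (mfderiv 𝓘(ℝ, EG) 𝓘(ℝ, EG) (fun z : G => z * 1) 1 : EG →L[ℝ] EG)
        = ContinuousLinearMap.id ℝ EG := by
      rw [e1]; exact mfderiv_id
    have a2 : (mfderiv 𝓘(ℝ, EG) 𝓘(ℝ, EG) (fun z : G => 1 * z) 1 : EG →L[ℝ] EG)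
        = ContinuousLinearMap.id ℝ EG := by
      rw [e2]; exact mfderiv_id
    refine ContinuousLinearMap.ext fun v => (mfderiv_prod_eq_add_apply hd).trans ?_
    exact congrArg₂ (fun (L L' : EG →L[ℝ] EG) => L v.1 + L' v.2) a1 a2
  rwa [e] at h

lemma Ad_one : Ad EG (1 : G) = ContinuousLinearMap.id ℝ EG := by
  have h := (hasMFDerivAt_conj (EG := EG) (1 : G) 1 rfl)
  have h2 : (fun h : G => 1 * h * 1⁻¹) = id := by ext; simp
  rw [h2] at h
  exact hasMFDerivAt_unique h (hasMFDerivAt_id 1)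

lemma Ad_mul (a b : G) : Ad EG (a * b) = (Ad EG a).comp (Ad EG b) := by
  have h := (hasMFDerivAt_conj (EG := EG) a (b * 1 * b⁻¹) (by simp)).comp 1
    (hasMFDerivAt_conj (EG := EG) b 1 rfl)
  have h2 : ((fun h : G => a * h * a⁻¹) ∘ fun h : G => b * h * b⁻¹)
      = fun h : G => (a * b) * h * (a * b)⁻¹ := by
    ext; simp [mul_assoc]
  rw [h2] at h
  exact hasMFDerivAt_unique (hasMFDerivAt_conj (EG := EG) (a * b) 1 rfl) h

lemma Ad_mul_apply (a b : G) (v : EG) : Ad EG (a * b) v = Ad EG a (Ad EG b v) := by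
  rw [Ad_mul]; rfl

lemma Ad_inv_apply (a : G) (v : EG) : Ad EG a⁻¹ (Ad EG a v) = v := by
  rw [← Ad_mul_apply, inv_mul_cancel, Ad_one]; rfl

lemma Ad_apply_inv (a : G) (v : EG) : Ad EG a (Ad EG a⁻¹ v) = v := by
  rw [← Ad_mul_apply, mul_inv_cancel, Ad_one]; rfl

end helpers

variable [LieGroup 𝓘(ℝ, EG) ∞ G]

variable (EG) in
/-- The Lie algebra of a (closed) subgroup `K` of `G`, as a subspace of `𝔤 = T₁G`: the velocities
at `1` of the smooth curves in `G` that lie in `K`. -/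
def lieAlg (K : Subgroup G) : Submodule ℝ EG where
  carrier := {v | ∃ γ : ℝ → G, (∀ t, γ t ∈ K) ∧ IsCurveWithVelocity (E := EG) γ 1 v}
  zero_mem' := by
    refine ⟨fun _ => 1, fun _ => K.one_mem, contMDiff_const, rfl, ?_⟩
    rw [mfderiv_const]; rfl
  add_mem' := by
    rintro v w ⟨γ, hγK, hγ, hγ0, rfl⟩ ⟨δ, hδK, hδ, hδ0, rfl⟩
    refine ⟨fun t => γ t * δ t, fun t => K.mul_mem (hγK t) (hδK t), hγ.mul hδ,
      by simp [hγ0, hδ0], ?_⟩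
    have h1 := ((hγ.mdifferentiable (by simp)) 0).hasMFDerivAt
    have h2 := ((hδ.mdifferentiable (by simp)) 0).hasMFDerivAt
    have h := (hasMFDerivAt_mul_one (EG := EG) (γ 0, δ 0)
      (by rw [hγ0, hδ0])).comp 0 (h1.prodMk h2)
    exact congrArg (fun L : ℝ →L[ℝ] EG => L 1) h.mfderiv
  smul_mem' := by
    rintro c v ⟨γ, hγK, hγ, hγ0, rfl⟩
    have hc : ContMDiff 𝓘(ℝ) 𝓘(ℝ) ∞ (fun t : ℝ => c * t) :=
      (contDiff_const.mul contDiff_id).contMDiff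
    refine ⟨fun t => γ (c * t), fun t => hγK _, hγ.comp hc, by simp [hγ0], ?_⟩
    have h0 : ∀ s : ℝ, s = 0 → HasMFDerivAt 𝓘(ℝ) 𝓘(ℝ, EG) γ s
        (mfderiv 𝓘(ℝ) 𝓘(ℝ, EG) γ 0 : ℝ →L[ℝ] EG) := by
      rintro s rfl
      exact ((hγ.mdifferentiable (by simp)) 0).hasMFDerivAt
    have h1 := h0 (c * 0) (mul_zero c)
    have h2 := ((hasFDerivAt_id (𝕜 := ℝ) (0 : ℝ)).const_mul c).hasMFDerivAt
    have h := (h1.comp (0 : ℝ) h2).mfderiv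
    refine (congrArg (fun L : ℝ →L[ℝ] EG => L 1) h).trans ?_
    exact (mfderiv 𝓘(ℝ) 𝓘(ℝ, EG) γ 0).map_smul c (1 : ℝ)

lemma Ad_mem_lieAlg {K : Subgroup G} {k : G} (hk : k ∈ K) {v : EG} (hv : v ∈ lieAlg EG K) :
    Ad EG k v ∈ lieAlg EG K := by
  obtain ⟨γ, hγK, hγ, hγ0, rfl⟩ := hv
  refine ⟨fun t => k * γ t * k⁻¹, fun t => K.mul_mem (K.mul_mem hk (hγK t)) (K.inv_mem hk),
    (contMDiff_conj k).comp hγ, by simp [hγ0], ?_⟩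
  have h1 := ((hγ.mdifferentiable (by simp)) 0).hasMFDerivAt
  have h := (hasMFDerivAt_conj (EG := EG) k (γ 0) hγ0).comp (0 : ℝ) h1
  exact congrArg (fun L : ℝ →L[ℝ] EG => L 1) h.mfderiv

variable (EG) in
/-- A Cartan decomposition `𝔤 = 𝔨 ⊕ 𝔪`, where `𝔨` is the Lie algebra of `K`: it is given by a
`G`-invariant symmetric bilinear form `B` on `𝔤` and a complement `𝔪` of `𝔨` such that `B` is
negative definite on `𝔨`, positive definite on `𝔪`, and `𝔨` and `𝔪` are `B`-orthogonal
(in particular `B` is non-degenerate). -/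
structure CartanDecomposition (K : Subgroup G) where
  /-- The invariant bilinear form. -/
  B : LinearMap.BilinForm ℝ EG
  symm : ∀ v w, B v w = B w v
  invariant : ∀ (g : G) (v w : EG), B (Ad EG g v) (Ad EG g w) = B v w
  /-- The complement `𝔪` of `𝔨`. -/
  m : Submodule ℝ EG
  isCompl : IsCompl (lieAlg EG K) m
  neg : ∀ v ∈ lieAlg EG K, v ≠ 0 → B v v < 0
  pos : ∀ v ∈ m, v ≠ 0 → 0 < B v v
  orthogonal : ∀ v ∈ lieAlg EG K, ∀ w ∈ m, B v w = 0

namespace CartanDecomposition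

variable {K : Subgroup G} (D : CartanDecomposition EG K)

/-- The projection of `𝔤 = 𝔨 ⊕ 𝔪` to `𝔨`. -/
def projK : EG →ₗ[ℝ] lieAlg EG K := Submodule.projectionOnto (lieAlg EG K) D.m D.isCompl

/-- The projection of `𝔤 = 𝔨 ⊕ 𝔪` to `𝔪`. -/
def projM : EG →ₗ[ℝ] D.m := Submodule.projectionOnto D.m (lieAlg EG K) D.isCompl.symm

lemma Ad_mem {k : G} (hk : k ∈ K) {v : EG} (hv : v ∈ D.m) : Ad EG k v ∈ D.m := by
  obtain ⟨a, ha, b, hb, hab⟩ := Submodule.mem_sup.1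
    (D.isCompl.sup_eq_top ▸ Submodule.mem_top : Ad EG k v ∈ lieAlg EG K ⊔ D.m)
  have h1 : D.B a (Ad EG k v) = 0 := by
    rw [← Ad_apply_inv (EG := EG) k a, D.invariant]
    exact D.orthogonal _ (Ad_mem_lieAlg (K.inv_mem hk) ha) _ hv
  have h2 : D.B a a = 0 := by
    have h3 : D.B a b = 0 := D.orthogonal a ha b hb
    rw [← hab, map_add, h3, add_zero] at h1
    exact h1
  have h4 : a = 0 := by
    by_contra h
    exact (D.neg a ha h).ne h2
  rw [← hab, h4, zero_add]
  exact hb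

/-- The adjoint action of `K` on `𝔪`. -/
def adM (k : K) : D.m →ₗ[ℝ] D.m :=
  ((Ad EG (k : G)).toLinearMap).restrict fun _ hv => D.Ad_mem k.2 hv

@[simp] lemma coe_adM (k : K) (v : D.m) : (D.adM k v : EG) = Ad EG (k : G) v := rfl

end CartanDecomposition

end LieGroup

/-! ### The associated bundle `G(𝔪) = G ×_K 𝔪` over a model `M` of `G/K` -/

section Assoc

variable {EG : Type*} [NormedAddCommGroup EG] [NormedSpace ℝ EG]
  {G : Type*} [TopologicalSpace G] [ChartedSpace EG G] [Group G] [LieGroup 𝓘(ℝ, EG) ∞ G]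
  {M : Type*} [MulAction G M] {p₀ : M}

/-- The fibre over `y` of the principal `K`-bundle `G → M`, `g ↦ g • p₀`, where `K` is the
stabilizer of `p₀`. -/
abbrev OrbitFibre (G : Type*) [Group G] {M : Type*} [MulAction G M] (p₀ y : M) : Type _ :=
  {g : G // g • p₀ = y}

variable (D : CartanDecomposition EG (MulAction.stabilizer G p₀))

/-- The equivalence relation `(g, v) ∼ (g k, Ad(k⁻¹) v)`, `k ∈ K`. -/
def assocSetoid (y : M) : Setoid (OrbitFibre G p₀ y × D.m) where
  r a b := ∃ k : MulAction.stabilizer G p₀,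
    (b.1 : G) = a.1 * k ∧ b.2 = D.adM k⁻¹ a.2
  iseqv := by
    refine ⟨fun a => ⟨1, by simp, ?_⟩, ?_, ?_⟩
    · ext; simp [Ad_one]
    · rintro a b ⟨k, h1, h2⟩
      refine ⟨k⁻¹, by simp [h1], ?_⟩
      ext; simp [h2, Ad_apply_inv]
    · rintro a b c ⟨k, h1, h2⟩ ⟨l, h3, h4⟩
      refine ⟨k * l, by simp [h1, h3, mul_assoc], ?_⟩
      ext; simp [h2, h4, Ad_mul_apply]

/-- The fibre over `y` of the associated bundle `G ×_K 𝔪`: the classes `[g, v]` with `g • p₀ = y`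
and `v ∈ 𝔪`, where `[g k, Ad(k⁻¹) v] = [g, v]` for `k ∈ K`. -/
def Assoc (y : M) : Type _ := Quotient (assocSetoid D y)

namespace Assoc

variable {D} {y : M}

/-- The class `[g, v]`. -/
def mk (g : OrbitFibre G p₀ y) (v : D.m) : Assoc D y := Quotient.mk (assocSetoid D y) (g, v)

/-- The element of `K` relating two points of the same fibre of `G → M`. -/
def diff (g h : OrbitFibre G p₀ y) : MulAction.stabilizer G p₀ :=
  ⟨(g : G)⁻¹ * h, by rw [MulAction.mem_stabilizer_iff, mul_smul, h.2, inv_smul_eq_iff, g.2]⟩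

/-- A point `g` of the fibre of `G → M` gives a bijection `v ↦ [g, v]`. -/
def frame (g : OrbitFibre G p₀ y) : D.m ≃ Assoc D y where
  toFun v := mk g v
  invFun := Quotient.lift (fun a => D.adM (diff g a.1) a.2) (by
    rintro a b ⟨k, h1, h2⟩
    ext
    simp only [CartanDecomposition.coe_adM, h2, diff, h1, ← Ad_mul_apply]
    congr 2
    simp [mul_assoc])
  left_inv v := by
    change D.adM (diff g g) v = v
    ext; simp [diff, Ad_one]
  right_inv := by
    rintro ⟨a⟩
    refine Quotient.sound ⟨diff g a.1, by simp [diff], ?_⟩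
    ext
    exact (Ad_inv_apply (EG := EG) _ _).symm

instance : TopologicalSpace (Assoc D y) :=
  inferInstanceAs (TopologicalSpace (Quotient (assocSetoid D y)))

lemma mk_eq_mk (g h : OrbitFibre G p₀ y) (v : D.m) :
    mk g v = mk h (D.adM (diff h g) v) := by
  refine Quotient.sound ⟨diff g h, by simp [diff], ?_⟩
  ext
  simp only [CartanDecomposition.coe_adM, diff]
  congr 2
  simp

/-- Left translation by `a`: the map `[g, v] ↦ [a g, v]` from the fibre over `y` to the fibre over
`a • y`. -/
def translate (a : G) {y' : M} (h : y' = a • y) : Assoc D y → Assoc D y' :=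
  Quotient.map (sa := assocSetoid D y) (sb := assocSetoid D y')
    (fun b => (⟨a * b.1, by rw [mul_smul, b.1.2, h]⟩, b.2)) (by
      rintro b c ⟨k, h1, h2⟩
      exact ⟨k, by simp [h1, mul_assoc], h2⟩)

variable [MulAction.IsPretransitive G M]

variable (p₀ y) in
/-- Some point of the fibre of `G → M` over `y`. -/
def somePoint : OrbitFibre G p₀ y :=
  ⟨(MulAction.exists_smul_eq G p₀ y).choose, (MulAction.exists_smul_eq G p₀ y).choose_spec⟩

/-- The vector space structure of the fibre, transported from `𝔪` along `v ↦ [g, v]`; by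
`frameₗ` it does not depend on the choice of `g`. -/
instance : AddCommGroup (Assoc D y) := (frame (D := D) (somePoint p₀ y)).symm.addCommGroup

instance : Module ℝ (Assoc D y) := (frame (D := D) (somePoint p₀ y)).symm.module ℝ

/-- For every point `g` of the fibre of `G → M`, the map `v ↦ [g, v]` is a linear isomorphism. -/
def frameₗ (g : OrbitFibre G p₀ y) : D.m ≃ₗ[ℝ] Assoc D y where
  __ := frame g
  map_add' v w := by
    have h := fun u : D.m => mk_eq_mk g (somePoint p₀ y) u
    change mk g (v + w) = frame (somePoint p₀ y)
      ((frame (somePoint p₀ y)).symm (mk g v) + (frame (somePoint p₀ y)).symm (mk g w))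
    rw [h v, h w, h (v + w), map_add]
    change frame _ _ = frame _ ((frame _).symm (frame _ _) + (frame _).symm (frame _ _))
    simp
  map_smul' c v := by
    have h := fun u : D.m => mk_eq_mk g (somePoint p₀ y) u
    change mk g (c • v) = frame (somePoint p₀ y) (c • (frame (somePoint p₀ y)).symm (mk g v))
    rw [h v, h (c • v), map_smul]
    change frame _ _ = frame _ (c • (frame _).symm (frame _ _))
    simp

end Assoc

variable (p₀) in
/-- The quotient map `G × 𝔪 → G ×_K 𝔪`, `(g, v) ↦ [g, v]`. -/
def assocQuot (a : G × D.m) : TotalSpace D.m (Assoc D) := ⟨a.1 • p₀, Assoc.mk ⟨a.1, rfl⟩ a.2⟩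

/-- The total space of `G ×_K 𝔪` carries the quotient topology of `G × 𝔪`. -/
instance : TopologicalSpace (TotalSpace D.m (Assoc D)) :=
  TopologicalSpace.coinduced (assocQuot p₀ D) inferInstance

end Assoc

/-! ### The universal covering and the fundamental group -/

/-- Let `p : Xt → X` be the universal covering, with group of deck transformations `Γ`.  This is
the canonical identification of `π₁(X, p x₀)` with `Γ`, through which `π₁(X, p x₀)` acts on `Xt`.
The inverse turns the canonical anti-homomorphism (the class of a loop goes to the deck
transformation moving `x₀` to the endpoint of the lift of the loop) into a homomorphism. -/
def deck {Xt X Γ : Type*} [TopologicalSpace Xt] [TopologicalSpace X] [Group Γ] [MulAction Γ Xt]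
    {p : Xt → X} (hp : IsQuotientCoveringMap p Γ) (x₀ : Xt) :
    FundamentalGroup X (p x₀) →* Γ where
  toFun c := (hp.fundamentalGroupToMulOpposite ⟨x₀, rfl⟩ c).unop⁻¹
  map_one' := by rw [map_one]; simp
  map_mul' a b := by rw [map_mul]; simp

/-! ### The reduction `E_K`, the flat connection and its decomposition

Everything is pulled back to the universal covering `Xt`.  There the flat bundle `E_G` with holonomy
`ρ` is the trivial bundle `Xt × G`, on which `c ∈ π₁(X)` acts by `(x, g) ↦ (c x, ρ(c) g)`, and the
reduction `E_K` defined by `f : Xt → M` is `f^* G = {(x, g) | g • p₀ = f x}`. -/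

section Reduction

variable {EX : Type*} [NormedAddCommGroup EX] [NormedSpace ℝ EX]
  {Xt : Type*} [TopologicalSpace Xt] [ChartedSpace EX Xt] [IsManifold 𝓘(ℝ, EX) ∞ Xt]
  {EG : Type*} [NormedAddCommGroup EG] [NormedSpace ℝ EG]
  {G : Type*} [TopologicalSpace G] [ChartedSpace EG G] [Group G] [LieGroup 𝓘(ℝ, EG) ∞ G]
  {EM : Type*} [NormedAddCommGroup EM] [NormedSpace ℝ EM]
  {M : Type*} [TopologicalSpace M] [ChartedSpace EM M] [MulAction G M] {p₀ : M}

/-- The tangent vectors of `E_K = {(x, g) | g • p₀ = f x}` at the point `(x, g)`: the velocities of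
the smooth curves in `Xt × G` that lie in `E_K`. -/
def IsTangentEK (p₀ : M) (f : Xt → M) (x : Xt) (g : G)
    (w : TangentSpace 𝓘(ℝ, EX) x × TangentSpace 𝓘(ℝ, EG) g) : Prop :=
  ∃ (a : ℝ → Xt) (b : ℝ → G), (∀ t, b t • p₀ = f (a t)) ∧
    IsCurveWithVelocity a x w.1 ∧ IsCurveWithVelocity b g w.2

/-- The flat connection `∇`, as a `𝔤`-valued connection form on the trivial bundle `Xt × G`. -/
def flatForm (x : Xt) (g : G) : TangentSpace 𝓘(ℝ, EX) x × TangentSpace 𝓘(ℝ, EG) g →ₗ[ℝ] EG :=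
  (maurerCartan g).toLinearMap ∘ₗ LinearMap.snd ℝ _ _

variable (D : CartanDecomposition EG (MulAction.stabilizer G p₀))

/-- The `𝔨`-part `D` of the flat connection. -/
def kForm (x : Xt) (g : G) :
    TangentSpace 𝓘(ℝ, EX) x × TangentSpace 𝓘(ℝ, EG) g →ₗ[ℝ]
      lieAlg EG (MulAction.stabilizer G p₀) :=
  D.projK ∘ₗ flatForm x g

/-- The `𝔪`-part `Ψ` of the flat connection, as an `𝔪`-valued form. -/
def mForm (x : Xt) (g : G) :
    TangentSpace 𝓘(ℝ, EX) x × TangentSpace 𝓘(ℝ, EG) g →ₗ[ℝ] D.m :=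
  D.projM ∘ₗ flatForm x g

/-- The `𝔨`-valued form `A` restricts to a connection form on the principal `K`-bundle
`E_K = {(x, g) | g • p₀ = f x}`, where `K` is the stabilizer of `p₀`. -/
structure IsKConnection (p₀ : M) (f : Xt → M)
    (A : ∀ (x : Xt) (g : G), TangentSpace 𝓘(ℝ, EX) x × TangentSpace 𝓘(ℝ, EG) g →ₗ[ℝ]
      lieAlg EG (MulAction.stabilizer G p₀)) : Prop where
  smooth : ContMDiff (𝓘(ℝ, EX).tangent.prod 𝓘(ℝ, EG).tangent)
    𝓘(ℝ, lieAlg EG (MulAction.stabilizer G p₀)) ∞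
    (fun z : TangentBundle 𝓘(ℝ, EX) Xt × TangentBundle 𝓘(ℝ, EG) G =>
      A z.1.1 z.2.1 (z.1.2, z.2.2))
  vertical : ∀ (x : Xt) (g : G), g • p₀ = f x →
    ∀ ξ : lieAlg EG (MulAction.stabilizer G p₀),
      A x g (0, (mfderiv 𝓘(ℝ, EG) 𝓘(ℝ, EG) (fun h : G => g * h) 1 (ξ : EG) : EG)) = ξ
  equivariant : ∀ (x : Xt) (g : G), g • p₀ = f x → ∀ k ∈ MulAction.stabilizer G p₀, ∀ w,
    IsTangentEK p₀ f x g w →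
      (A x (g * k) (w.1, mfderiv 𝓘(ℝ, EG) 𝓘(ℝ, EG) (fun h : G => h * k) g w.2) : EG)
        = Ad EG k⁻¹ (A x g w)

variable [MulAction.IsPretransitive G M]

/-- `Ψ` is the one-form on `Xt` with values in `E_K(𝔪) = f^*(G ×_K 𝔪)` that corresponds to the
`𝔪`-part of the flat connection on `E_K`: at `x` it maps the projection `w.1` of a tangent vector
`w` of `E_K` at `(x, g)` to the class `[g, Ψ(w)]`. -/
def IsMPart (f : Xt → M)
    (Ψ : ∀ x : Xt, TangentSpace 𝓘(ℝ, EX) x →ₗ[ℝ] (f *ᵖ (Assoc D)) x) : Prop :=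
  ∀ (x : Xt) (g : OrbitFibre G p₀ (f x)) (w : TangentSpace 𝓘(ℝ, EX) x ×
    TangentSpace 𝓘(ℝ, EG) (g : G)), IsTangentEK p₀ f x (g : G) w →
      Ψ x w.1 = Assoc.mk g (mForm D x (g : G) w)

/-- The action of `(φ, a)` on `E_K(𝔪) = f^*(G ×_K 𝔪)`, where `φ : Xt → Xt` and `a : G` satisfy
`f (φ x) = a • f x`: it maps the class `[g, v]` over `x` to the class `[a g, v]` over `φ x`. -/
def actAssoc (f : Xt → M) (φ : Xt → Xt) (a : G) (h : ∀ x, f (φ x) = a • f x)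
    (z : TotalSpace D.m (f *ᵖ (Assoc D))) : TotalSpace D.m (f *ᵖ (Assoc D)) :=
  ⟨φ z.1, Assoc.translate a (h z.1) z.2⟩

/-- The action of `(φ, a)` on `f^* TM`, where `f (φ x) = a • f x`: it maps a tangent vector `w` of
`M` at `f x` to its image under the differential of `y ↦ a • y`, a tangent vector at
`a • f x = f (φ x)`. -/
def actTangent (f : Xt → M) (φ : Xt → Xt) (a : G)
    (z : TotalSpace EM (f *ᵖ (TangentSpace 𝓘(ℝ, EM) : M → Type _))) :
    TotalSpace EM (f *ᵖ (TangentSpace 𝓘(ℝ, EM) : M → Type _)) :=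
  ⟨φ z.1, (mfderiv 𝓘(ℝ, EM) 𝓘(ℝ, EM) (fun y : M => a • y) (f z.1) z.2 : EM)⟩

end Reduction

end

end SymBundle

/-! The whole theorem rests on the orbit map `g ↦ g • p₀`. By equivariance its differential at `g`
is `orbitDeriv` at `g` composed with the Maurer--Cartan form, and its rank does not depend on `g`.
Constant rank identifies the kernel of `orbitDeriv` with the Lie algebra `𝔨` of the stabilizer
(`mem_lieAlg_iff_orbitDeriv`). Since `G` is second countable, a Baire argument shows that the orbit
map is open, and an open map of constant rank is a submersion (`surjective_orbitDeriv`). Hence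
`orbitDeriv` at `g` restricts to an isomorphism `𝔪 ≅ T_{g p₀} M`, and the orbit map has smooth local
sections.

The local sections trivialize `G ×_K 𝔪`, with transition functions given by `Ad` of elements of `K`;
here `Ad(K) 𝔪 ⊆ 𝔪` comes from the invariance and definiteness of `B`. The isomorphisms `𝔪 ≅ T_{g p₀}
M` are compatible with `[g k, Ad(k⁻¹) v] = [g, v]` and with left translation, so they glue to an
equivariant isomorphism `G ×_K 𝔪 ≅ TM` (`assocEquiv`). Its pullback along `f` is `Φ`.

Differentiating the equation `g • p₀ = f x` of `E_K` along a tangent vector `(u, w)` gives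
`orbitDeriv g (ω(w)) = df(u)`. The `𝔨`-part of `ω(w)` is killed, so `[g, pr_𝔪 ω(w)]` is the inverse
image of `df(u)` under `Φ`. It therefore depends on `u` alone, and this gives at once the existence
of `Ψ`, its smoothness, its equivariance and `Φ ∘ Ψ = df` (`isMPart_iff`). -/

namespace SymBundle

noncomputable section

/-! ### The constant rank theorem in normed spaces. -/

section ConstantRank

open Set Filter Topology Module

variable {E F : Type*} [NormedAddCommGroup E] [NormedSpace ℝ E] [FiniteDimensional ℝ E]
  [NormedAddCommGroup F] [NormedSpace ℝ F]

/-- The inverse function theorem for smooth maps, with an inverse that is smooth on an open set. -/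
theorem exists_openPartialHomeomorph_contDiffOn {f : E → F} {U : Set E} (hU : IsOpen U) {x₀ : E}
    (hx₀ : x₀ ∈ U) (hf : ContDiffOn ℝ ∞ f U) (L : E ≃L[ℝ] F)
    (hL : HasFDerivAt f (L : E →L[ℝ] F) x₀) :
    ∃ e : OpenPartialHomeomorph E F, x₀ ∈ e.source ∧ e.source ⊆ U ∧ (∀ x, e x = f x) ∧
      ContDiffOn ℝ ∞ e.symm e.target := by
  have hat : ContDiffAt ℝ ∞ f x₀ := hf.contDiffAt (hU.mem_nhds hx₀)
  let e₀ := hat.toOpenPartialHomeomorph f hL (by simp)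
  have he₀ : ∀ x, e₀ x = f x := fun x => rfl
  have hx₀e : x₀ ∈ e₀.source := hat.mem_toOpenPartialHomeomorph_source hL (by simp)
  have hcont : ContinuousOn (fderiv ℝ f) U := hf.continuousOn_fderiv_of_isOpen hU (by simp)
  have hnhds : range ((↑) : (E ≃L[ℝ] F) → E →L[ℝ] F) ∈ 𝓝 (fderiv ℝ f x₀) := by
    rw [hL.fderiv]; exact L.nhds
  -- Invertibility of the differential is an open condition. After shrinking to this set the local
  -- inverse is smooth at every point of the target, not only at the image of `x₀`.
  have hV : U ∩ fderiv ℝ f ⁻¹' (range ((↑) : (E ≃L[ℝ] F) → E →L[ℝ] F)) ∈ 𝓝 x₀ :=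
    inter_mem (hU.mem_nhds hx₀) ((hcont.continuousAt (hU.mem_nhds hx₀)) hnhds)
  obtain ⟨V, hVs, hVo, hxV⟩ := mem_nhds_iff.1 hV
  refine ⟨e₀.restrOpen V hVo, by simpa using ⟨hx₀e, hxV⟩, fun x hx => ?_, he₀, ?_⟩
  · exact (hVs (by simpa using hx.2)).1
  · intro y hy
    have hy' : y ∈ e₀.target ∧ e₀.symm y ∈ V := by
      simpa using hy
    obtain ⟨hyU, L', hL'⟩ := hVs hy'.2
    have hd : ContDiffAt ℝ ∞ f (e₀.symm y) := hf.contDiffAt (hU.mem_nhds hyU)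
    have := e₀.contDiffAt_symm (n := ∞) (f₀' := L') hy'.1
      (by rw [hL']; exact (hd.differentiableAt (by simp)).hasFDerivAt) hd
    exact this.contDiffWithinAt

/-- The constant rank theorem: near `x₀`, the map `f` factors through the projection of suitable
coordinates `(y, n)` to `y`, where `y` runs through the range and `n` through the kernel of the
differential at `x₀`. -/
theorem constant_rank {f : E → F} {U : Set E} (hU : IsOpen U) {x₀ : E}
    (hx₀ : x₀ ∈ U) (hf : ContDiffOn ℝ ∞ f U) {L : E →L[ℝ] F} (hL : HasFDerivAt f L x₀)
    (hr : ∀ x ∈ U, finrank ℝ (fderiv ℝ f x).range ≤ finrank ℝ L.range) :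
    ∃ (Q : F →L[ℝ] L.range) (e : OpenPartialHomeomorph E (L.range × L.ker))
      (W : Set L.range) (W' : Set L.ker),
      (∀ y : L.range, Q y = y) ∧ IsOpen W ∧ IsOpen W' ∧ Convex ℝ W ∧ Convex ℝ W' ∧ Q (f x₀) ∈ W ∧
      (0 : L.ker) ∈ W' ∧ W ×ˢ W' ⊆ e.target ∧ x₀ ∈ e.source ∧ e.source ⊆ U ∧
      e x₀ = (Q (f x₀), 0) ∧ (∀ x, (e x).1 = Q (f x)) ∧
      ContDiffOn ℝ ∞ e.symm e.target ∧
      (∀ y ∈ W, ∀ n ∈ W', f (e.symm (y, n)) = f (e.symm (y, 0))) ∧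
      ∀ n : L.ker, HasDerivAt (fun t : ℝ => e.symm (Q (f x₀), t • n)) (n : E) 0 := by
  obtain ⟨Q, hQ⟩ := Submodule.ClosedComplemented.of_finiteDimensional (𝕜 := ℝ) L.range
  obtain ⟨P, hP⟩ := Submodule.ClosedComplemented.of_finiteDimensional (𝕜 := ℝ) L.ker
  -- `Q` and `P` are linear projections onto the range and the kernel of `L`. The differential `T`
  -- of `Θ` at `x₀` is injective because `Q` is the identity on the range and `P` on the kernel; by
  -- rank-nullity it is invertible.
  let Θ : E → L.range × L.ker := fun x => (Q (f x), P (x - x₀))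
  let T : E →L[ℝ] L.range × L.ker := (Q.comp L).prod P
  have hTinj : Function.Injective T := by
    rw [injective_iff_map_eq_zero]
    intro v hv
    have h1 : Q (L v) = 0 := congrArg Prod.fst hv
    have h2 : P v = 0 := congrArg Prod.snd hv
    have h3 : L v = 0 := by
      have := hQ ⟨L v, LinearMap.mem_range_self _ v⟩
      rw [h1] at this
      exact (congrArg Subtype.val this).symm
    have := hP ⟨v, h3⟩
    rw [h2] at this
    exact (congrArg Subtype.val this).symm
  have hdim : finrank ℝ E = finrank ℝ (L.range × L.ker) := by
    rw [Module.finrank_prod]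
    exact (LinearMap.finrank_range_add_finrank_ker (L : E →ₗ[ℝ] F)).symm
  let Te : E ≃L[ℝ] L.range × L.ker := (LinearEquiv.ofBijective (T : E →ₗ[ℝ] L.range × L.ker)
    ⟨hTinj, (LinearMap.injective_iff_surjective_of_finrank_eq_finrank
      hdim).1 hTinj⟩).toContinuousLinearEquiv
  have hTe : (Te : E →L[ℝ] L.range × L.ker) = T := by ext <;> rfl
  have hΘ : ContDiffOn ℝ ∞ Θ U :=
    (Q.contDiff.comp_contDiffOn hf).prodMk
      (P.contDiff.comp (contDiff_id.sub contDiff_const)).contDiffOn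
  have hΘd : HasFDerivAt Θ (Te : E →L[ℝ] L.range × L.ker) x₀ := by
    rw [hTe]
    exact (Q.hasFDerivAt.comp x₀ hL).prodMk
      (by
        have h := P.hasFDerivAt.comp x₀ ((hasFDerivAt_id x₀).sub_const x₀)
        rw [ContinuousLinearMap.comp_id] at h
        exact h)
  obtain ⟨e, hxe, heU, he, hes⟩ := exists_openPartialHomeomorph_contDiffOn hU hx₀ hΘ Te hΘd
  have hex₀ : e x₀ = (Q (f x₀), 0) := by rw [he]; simp [Θ]
  have htn : e.target ∈ 𝓝 ((Q (f x₀), 0) : L.range × L.ker) :=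
    e.open_target.mem_nhds (hex₀ ▸ e.map_source hxe)
  rw [nhds_prod_eq] at htn
  obtain ⟨W₀, hW₀, W₁, hW₁, hWW⟩ := mem_prod_iff.1 htn
  obtain ⟨r₀, hr₀, hb₀⟩ := Metric.mem_nhds_iff.1 hW₀
  obtain ⟨r₁, hr₁, hb₁⟩ := Metric.mem_nhds_iff.1 hW₁
  have hsub : Metric.ball (Q (f x₀)) r₀ ×ˢ Metric.ball (0 : L.ker) r₁ ⊆ e.target :=
    (prod_mono hb₀ hb₁).trans hWW
  refine ⟨Q, e, Metric.ball (Q (f x₀)) r₀, Metric.ball 0 r₁, hQ, Metric.isOpen_ball,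
    Metric.isOpen_ball, convex_ball _ _, convex_ball _ _, Metric.mem_ball_self hr₀,
    Metric.mem_ball_self hr₁, hsub, hxe, heU, hex₀, fun x => by rw [he], hes, ?_, ?_⟩
  · intro y hy n hn
    have hG : ∀ n ∈ Metric.ball (0 : L.ker) r₁,
        HasFDerivAt (fun n => f (e.symm (y, n))) (0 : L.ker →L[ℝ] F) n := by
      intro n hn
      have hmem : (y, n) ∈ e.target := hsub ⟨hy, hn⟩
      have hxU : e.symm (y, n) ∈ U := heU (e.map_target hmem)
      have h1 : HasFDerivAt f (fderiv ℝ f (e.symm (y, n))) (e.symm (y, n)) :=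
        ((hf.contDiffAt (hU.mem_nhds hxU)).differentiableAt (by simp)).hasFDerivAt
      have h2 : HasFDerivAt e.symm (fderiv ℝ e.symm (y, n)) (y, n) :=
        ((hes.contDiffAt (e.open_target.mem_nhds hmem)).differentiableAt (by simp)).hasFDerivAt
      have h3 := h1.comp (y, n) h2
      set A := fderiv ℝ f (e.symm (y, n))
      set S := fderiv ℝ e.symm (y, n)
      have h4 : HasFDerivAt (fun z : L.range × L.ker => Q (f (e.symm z)))
          (ContinuousLinearMap.fst ℝ _ _) (y, n) := by
        refine (ContinuousLinearMap.fst ℝ L.range L.ker).hasFDerivAt.congr_of_eventuallyEq ?_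
        filter_upwards [e.open_target.mem_nhds hmem] with z hz
        have := congrArg Prod.fst ((he (e.symm z)).symm.trans (e.right_inv hz))
        exact this
      have h5 : Q.comp (A.comp S) = ContinuousLinearMap.fst ℝ _ _ :=
        (Q.hasFDerivAt.comp (y, n) h3).unique h4
      -- `Q` maps the range of `A` onto that of `L`, since `Q ∘ A ∘ S` is the first projection. The
      -- rank bound makes this surjection injective. So the derivative of `f ∘ e.symm` in the kernel
      -- direction, which `Q` kills, vanishes, and `f ∘ e.symm` is constant along the slices.
      have h6 : ∀ w ∈ A.range, Q w = 0 → w = 0 := by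
        let q : A.range →ₗ[ℝ] L.range := (Q : F →ₗ[ℝ] L.range) ∘ₗ A.range.subtype
        have hq : Function.Surjective q := fun z =>
          ⟨⟨A (S (z, 0)), LinearMap.mem_range_self _ _⟩,
            congrArg (fun B : L.range × L.ker →L[ℝ] L.range => B (z, 0)) h5⟩
        have hle : finrank ℝ L.range ≤ finrank ℝ A.range :=
          LinearMap.finrank_le_finrank_of_surjective hq
        have hqi : Function.Injective q :=
          (LinearMap.injective_iff_surjective_of_finrank_eq_finrank
            (le_antisymm (hr _ hxU) hle)).2 hq
        intro w hw hw0
        have := hqi (a₁ := ⟨w, hw⟩) (a₂ := 0) (by simpa [q] using hw0)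
        exact congrArg Subtype.val this
      have h7 : (A.comp S).comp (ContinuousLinearMap.inr ℝ L.range L.ker) = 0 := by
        ext v
        refine h6 _ (LinearMap.mem_range_self _ _) ?_
        exact congrArg (fun B : L.range × L.ker →L[ℝ] L.range => B (0, v)) h5
      rw [← h7]
      exact h3.comp n (hasFDerivAt_prodMk_right y n)
    exact Metric.isOpen_ball.is_const_of_fderiv_eq_zero (𝕜 := ℝ)
      (f := fun n => f (e.symm (y, n))) (convex_ball _ _).isPreconnected
      (fun n hn => (hG n hn).differentiableAt.differentiableWithinAt)
      (fun n hn => (hG n hn).fderiv) hn (Metric.mem_ball_self hr₁)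
  · intro n
    have hmem : (Q (f x₀), (0 : L.ker)) ∈ e.target := hex₀ ▸ e.map_source hxe
    have hsx : e.symm (Q (f x₀), 0) = x₀ := by rw [← hex₀, e.left_inv hxe]
    have h1 : HasFDerivAt e.symm (Te.symm : L.range × L.ker →L[ℝ] E) (Q (f x₀), 0) := by
      refine e.hasFDerivAt_symm hmem ?_
      rw [hsx]
      exact hΘd.congr_of_eventuallyEq (Eventually.of_forall he)
    have h2 : HasDerivAt (fun t : ℝ => ((Q (f x₀), t • n) : L.range × L.ker)) (0, n) 0 := by
      refine (hasDerivAt_const 0 _).prodMk ?_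
      simpa using (hasDerivAt_id (0 : ℝ)).smul_const n
    have h3 := HasFDerivAt.comp_hasDerivAt (0 : ℝ)
      (f := fun t : ℝ => ((Q (f x₀), t • n) : L.range × L.ker))
      (l := e.symm) (by simpa using h1) h2
    -- The differential of `e.symm` is the inverse of `T`, and `T n = (0, n)` for `n` in the kernel.
    have h4 : Te.symm ((0 : L.range), n) = (n : E) := by
      rw [ContinuousLinearEquiv.symm_apply_eq]
      have h5 : L (n : E) = 0 := n.2
      change _ = (Q (L n), P n)
      rw [h5, hP, map_zero]
    have h5 : (Te.symm : L.range × L.ker →L[ℝ] E) ((0 : L.range), n) = (n : E) := h4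
    rw [h5] at h3
    exact h3

end ConstantRank

/-! ### Maps of constant rank between manifolds: submersions, curves in fibres, local sections. -/

section ConstantRankManifold

open Set Filter Topology Module

variable {E F : Type*} [NormedAddCommGroup E] [NormedSpace ℝ E]
  [NormedAddCommGroup F] [NormedSpace ℝ F]
  {N : Type*} [TopologicalSpace N] [ChartedSpace E N]
  {M : Type*} [TopologicalSpace M] [ChartedSpace F M] [IsManifold 𝓘(ℝ, F) ∞ M]

/-- A smooth map `ℝ → (-δ, δ)` that is tangent to the identity at `0`. -/
theorem exists_bounded_reparametrization {δ : ℝ} (hδ : 0 < δ) :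
    ∃ η : ℝ → ℝ, ContDiff ℝ ∞ η ∧ η 0 = 0 ∧ HasDerivAt η 1 0 ∧ ∀ t, |η t| < δ := by
  have h2 : 0 < δ / 2 := by positivity
  -- The sine keeps the values within `δ / 2`, and the two factors cancel in the derivative at `0`.
  refine ⟨fun t => δ / 2 * Real.sin ((δ / 2)⁻¹ * t), ?_, by simp, ?_, fun t => ?_⟩
  · exact contDiff_const.mul (Real.contDiff_sin.comp (contDiff_const.mul contDiff_id))
  · have h := (((hasDerivAt_id (0 : ℝ)).const_mul (δ / 2)⁻¹).sin).const_mul (δ / 2)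
    simpa [h2.ne', hδ.ne'] using h
  · rw [abs_mul, abs_of_pos h2]
    nlinarith [Real.abs_sin_le_one ((δ / 2)⁻¹ * t)]

/-- A curve that is smooth near `0` may be replaced by a smooth curve on `ℝ` with the same
velocity that stays in a given neighbourhood. -/
theorem exists_isCurveWithVelocity {c : ℝ → E} {U : Set E} {x₀ v : E}
    (hx₀ : c 0 = x₀) {δ : ℝ} (hδ : 0 < δ) (hc : ContDiffOn ℝ ∞ c (Metric.ball 0 δ))
    (hcU : ∀ t ∈ Metric.ball (0 : ℝ) δ, c t ∈ U) (hv : HasDerivAt c v 0)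
    {ψ : E → N} (hψ : ContMDiffOn 𝓘(ℝ, E) 𝓘(ℝ, E) ∞ ψ U) {L : E →L[ℝ] E}
    (hL : HasMFDerivAt 𝓘(ℝ, E) 𝓘(ℝ, E) ψ x₀ L) :
    ∃ γ : ℝ → N, IsCurveWithVelocity γ (ψ x₀) (L v) ∧
      ∀ t, ∃ τ ∈ Metric.ball (0 : ℝ) δ, γ t = ψ (c τ) := by
  obtain ⟨η, hη, hη0, hηd, hηb⟩ := exists_bounded_reparametrization hδ
  have hb : ∀ t, η t ∈ Metric.ball (0 : ℝ) δ := fun t => by simpa using hηb t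
  have hcη : ContDiff ℝ ∞ (c ∘ η) := by
    rw [← contDiffOn_univ]
    exact hc.comp hη.contDiffOn fun t _ => hb t
  refine ⟨ψ ∘ c ∘ η, ⟨?_, by simp [hη0, hx₀], ?_⟩, fun t => ⟨η t, hb t, rfl⟩⟩
  · rw [← contMDiffOn_univ]
    exact hψ.comp hcη.contMDiff.contMDiffOn fun t _ => hcU _ (hb t)
  · have h1 : HasDerivAt (c ∘ η) ((1 : ℝ) • v) 0 :=
      HasDerivAt.scomp (0 : ℝ) (by rwa [hη0]) hηd
    rw [one_smul] at h1
    have h0 : (c ∘ η) 0 = x₀ := by simp [hη0, hx₀]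
    have h2 : HasMFDerivAt 𝓘(ℝ, E) 𝓘(ℝ, E) ψ ((c ∘ η) 0) L := by rw [h0]; exact hL
    have h3 := (h2.comp (0 : ℝ) h1.hasFDerivAt.hasMFDerivAt).mfderiv
    refine (congrArg (fun A : ℝ →L[ℝ] E => A 1) h3).trans ?_
    change L ((1 : ℝ) • v) = L v
    rw [one_smul]

variable [IsManifold 𝓘(ℝ, E) ∞ N]

-- The tangent space at `p` is identified with `E` through the preferred chart at `p`, so in this
-- chart the differential at `p` is the identity.
variable (N) in
theorem hasMFDerivAt_extChartAt_symm_self (p : N) :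
    HasMFDerivAt 𝓘(ℝ, E) 𝓘(ℝ, E) (extChartAt 𝓘(ℝ, E) p).symm (extChartAt 𝓘(ℝ, E) p p)
      (ContinuousLinearMap.id ℝ E) := by
  have hd : MDifferentiableAt 𝓘(ℝ, E) 𝓘(ℝ, E) (extChartAt 𝓘(ℝ, E) p).symm
      (extChartAt 𝓘(ℝ, E) p p) :=
    ((contMDiffOn_extChartAt_symm (n := ∞) p).contMDiffAt
      ((isOpen_extChartAt_target p).mem_nhds (mem_extChartAt_target p))).mdifferentiableAt (by simp)
  have h := hd.hasMFDerivAt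
  have e : (mfderiv 𝓘(ℝ, E) 𝓘(ℝ, E) (extChartAt 𝓘(ℝ, E) p).symm (extChartAt 𝓘(ℝ, E) p p)
      : E →L[ℝ] E) = ContinuousLinearMap.id ℝ E := by
    have h' := mfderivWithin_range_extChartAt_symm (I := 𝓘(ℝ, E)) (x := p)
    rw [ModelWithCorners.range_eq_univ, mfderivWithin_univ] at h'
    exact h'
  rwa [e] at h

variable {φ : N → M}

/-- The coordinate expression of a smooth map. -/
theorem contDiffOn_writtenInExtChartAt (hφ : ContMDiff 𝓘(ℝ, E) 𝓘(ℝ, F) ∞ φ) (p : N) :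
    IsOpen ((extChartAt 𝓘(ℝ, E) p).target ∩
      (extChartAt 𝓘(ℝ, E) p).symm ⁻¹' (φ ⁻¹' (extChartAt 𝓘(ℝ, F) (φ p)).source)) ∧
    ContDiffOn ℝ ∞ (writtenInExtChartAt 𝓘(ℝ, E) 𝓘(ℝ, F) p φ)
      ((extChartAt 𝓘(ℝ, E) p).target ∩
        (extChartAt 𝓘(ℝ, E) p).symm ⁻¹' (φ ⁻¹' (extChartAt 𝓘(ℝ, F) (φ p)).source)) := by
  constructor
  · exact (continuousOn_extChartAt_symm p).isOpen_inter_preimage (isOpen_extChartAt_target p)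
      ((isOpen_extChartAt_source (φ p)).preimage hφ.continuous)
  · rw [← contMDiffOn_iff_contDiffOn]
    exact contMDiffOn_extChartAt.comp (hφ.comp_contMDiffOn
      ((contMDiffOn_extChartAt_symm p).mono inter_subset_left))
      fun x hx => by simpa using hx.2

variable [FiniteDimensional ℝ E]

/-- The coordinate expression composes the map with charts on both sides, and composition with
linear maps cannot raise the rank. This carries a rank bound on the manifold over to coordinates. -/
theorem finrank_range_fderiv_writtenInExtChartAt_le (p : N)
    {x : E} (hx : x ∈ (extChartAt 𝓘(ℝ, E) p).target ∩
      (extChartAt 𝓘(ℝ, E) p).symm ⁻¹' (φ ⁻¹' (extChartAt 𝓘(ℝ, F) (φ p)).source))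
    {L : E →L[ℝ] F} (hL : HasMFDerivAt 𝓘(ℝ, E) 𝓘(ℝ, F) φ ((extChartAt 𝓘(ℝ, E) p).symm x) L) :
    finrank ℝ (fderiv ℝ (writtenInExtChartAt 𝓘(ℝ, E) 𝓘(ℝ, F) p φ) x).range
      ≤ finrank ℝ L.range := by
  have h1 : MDifferentiableAt 𝓘(ℝ, E) 𝓘(ℝ, E) (extChartAt 𝓘(ℝ, E) p).symm x :=
    ((contMDiffOn_extChartAt_symm (n := ∞) p).contMDiffAt
      ((isOpen_extChartAt_target p).mem_nhds hx.1)).mdifferentiableAt (by simp)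
  have h2 : MDifferentiableAt 𝓘(ℝ, F) 𝓘(ℝ, F) (extChartAt 𝓘(ℝ, F) (φ p))
      (φ ((extChartAt 𝓘(ℝ, E) p).symm x)) :=
    mdifferentiableAt_extChartAt (by simpa using hx.2)
  obtain ⟨A, hA⟩ : ∃ A : E →L[ℝ] E, HasMFDerivAt 𝓘(ℝ, E) 𝓘(ℝ, E)
    (extChartAt 𝓘(ℝ, E) p).symm x A := ⟨_, h1.hasMFDerivAt⟩
  obtain ⟨B, hB⟩ : ∃ B : F →L[ℝ] F, HasMFDerivAt 𝓘(ℝ, F) 𝓘(ℝ, F)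
    (extChartAt 𝓘(ℝ, F) (φ p)) (φ ((extChartAt 𝓘(ℝ, E) p).symm x)) B := ⟨_, h2.hasMFDerivAt⟩
  have h3 : HasFDerivAt (writtenInExtChartAt 𝓘(ℝ, E) 𝓘(ℝ, F) p φ) (B.comp (L.comp A)) x :=
    (hB.comp x (hL.comp x hA)).hasFDerivAt
  rw [h3.fderiv]
  have h4 : (B.comp (L.comp A)).range ≤ L.range.map (B : F →ₗ[ℝ] F) := by
    rintro _ ⟨v, rfl⟩
    exact ⟨L (A v), LinearMap.mem_range_self _ _, rfl⟩
  exact (Submodule.finrank_mono h4).trans (Submodule.finrank_map_le _ _)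

variable {L : E →L[ℝ] F} {p : N}

variable [FiniteDimensional ℝ F] in
/-- A smooth map of constant rank that is open is a submersion. -/
theorem surjective_of_isOpenMap_of_constant_rank (hφ : ContMDiff 𝓘(ℝ, E) 𝓘(ℝ, F) ∞ φ)
    (hL : HasMFDerivAt 𝓘(ℝ, E) 𝓘(ℝ, F) φ p L)
    (hr : ∀ q, ∃ A : E →L[ℝ] F, HasMFDerivAt 𝓘(ℝ, E) 𝓘(ℝ, F) φ q A ∧
      finrank ℝ A.range ≤ finrank ℝ L.range)
    (hopen : IsOpenMap φ) : Function.Surjective L := by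
  obtain ⟨hUo, hf⟩ := contDiffOn_writtenInExtChartAt hφ p
  set f := writtenInExtChartAt 𝓘(ℝ, E) 𝓘(ℝ, F) p φ
  set U := (extChartAt 𝓘(ℝ, E) p).target ∩
      (extChartAt 𝓘(ℝ, E) p).symm ⁻¹' (φ ⁻¹' (extChartAt 𝓘(ℝ, F) (φ p)).source)
  set x₀ := extChartAt 𝓘(ℝ, E) p p
  have hx₀ : x₀ ∈ U := ⟨mem_extChartAt_target p, by simp [x₀]⟩
  have hLf : HasFDerivAt f L x₀ := by
    have h := hL.2
    rw [ModelWithCorners.range_eq_univ] at h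
    exact hasFDerivWithinAt_univ.1 h
  obtain ⟨Q, e, W, W', hQ, hWo, hWo', hWc, hWc', hQW, h0W', hWW, hxe, heU, hex, he1, hes, hconst,
    -⟩ := constant_rank hUo hx₀ hf hLf fun x hx => by
      obtain ⟨A, hA, hAr⟩ := hr ((extChartAt 𝓘(ℝ, E) p).symm x)
      exact (finrank_range_fderiv_writtenInExtChartAt_le p hx hA).trans hAr
  by_contra hns
  have hlt : finrank ℝ L.range < finrank ℝ F := by
    refine Submodule.finrank_lt fun h => hns ?_
    exact LinearMap.range_eq_top.1 h
  -- By constant rank, near `p` all values of `f` are already attained on the slice `W × {0}`. Its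
  -- dimension is less than that of `F`, so by Hausdorff dimension the image has dense complement,
  -- whereas openness of `φ` makes the image of a neighbourhood of `p` open in coordinates.
  have hd : Dense ((fun y : L.range => f (e.symm (y, 0))) '' W)ᶜ := by
    refine ContDiffOn.dense_compl_image_of_dimH_lt_finrank (s := W) (t := W) ?_ hWc subset_rfl ?_
    · have h1 : ContDiffOn ℝ ∞ (fun y : L.range => f (e.symm (y, 0))) W := by
        refine (hf.comp hes fun z hz => heU (e.map_target hz)).comp
          (contDiff_id.prodMk contDiff_const).contDiffOn fun y hy => hWW ⟨hy, h0W'⟩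
      exact h1.of_le (by simp)
    · exact ((dimH_mono (subset_univ W)).trans_eq (Real.dimH_univ_eq_finrank _)).trans_lt
        (by exact_mod_cast hlt)
  have hO : IsOpen (e.source ∩ e ⁻¹' (W ×ˢ W')) := e.isOpen_inter_preimage (hWo.prod hWo')
  have hV : IsOpen ((extChartAt 𝓘(ℝ, E) p).source ∩
      extChartAt 𝓘(ℝ, E) p ⁻¹' (e.source ∩ e ⁻¹' (W ×ˢ W'))) :=
    (continuousOn_extChartAt p).isOpen_inter_preimage (isOpen_extChartAt_source p) hO
  have hVφ := hopen _ hV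
  have hφo : IsOpen ((extChartAt 𝓘(ℝ, F) (φ p)).target ∩ (extChartAt 𝓘(ℝ, F) (φ p)).symm ⁻¹'
      (φ '' ((extChartAt 𝓘(ℝ, E) p).source ∩
      extChartAt 𝓘(ℝ, E) p ⁻¹' (e.source ∩ e ⁻¹' (W ×ˢ W'))))) :=
    (continuousOn_extChartAt_symm (φ p)).isOpen_inter_preimage (isOpen_extChartAt_target (φ p)) hVφ
  obtain ⟨z, hz, hzc⟩ := hd.exists_mem_open hφo ⟨extChartAt 𝓘(ℝ, F) (φ p) (φ p),
    mem_extChartAt_target _, by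
      refine ⟨p, ⟨mem_extChartAt_source p, hxe, ?_⟩, by simp⟩
      change e x₀ ∈ (W ×ˢ W' : Set _)
      rw [hex]; exact ⟨hQW, h0W'⟩⟩
  obtain ⟨hzt, q, ⟨hqs, hqe, hqW⟩, hq⟩ := hzc
  refine hz ⟨(e (extChartAt 𝓘(ℝ, E) p q)).1, hqW.1, ?_⟩
  have h1 := hconst _ hqW.1 _ hqW.2
  simp only at h1 ⊢
  rw [← h1, e.left_inv hqe]
  change extChartAt 𝓘(ℝ, F) (φ p) (φ ((extChartAt 𝓘(ℝ, E) p).symm (extChartAt 𝓘(ℝ, E) p q))) = z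
  rw [(extChartAt 𝓘(ℝ, E) p).left_inv hqs, hq, (extChartAt 𝓘(ℝ, F) (φ p)).right_inv hzt]

/-- The kernel of the differential of a smooth map of constant rank consists of the velocities of
the smooth curves in the fibre. -/
theorem exists_curve_in_fibre_of_constant_rank (hφ : ContMDiff 𝓘(ℝ, E) 𝓘(ℝ, F) ∞ φ)
    (hL : HasMFDerivAt 𝓘(ℝ, E) 𝓘(ℝ, F) φ p L)
    (hr : ∀ q, ∃ A : E →L[ℝ] F, HasMFDerivAt 𝓘(ℝ, E) 𝓘(ℝ, F) φ q A ∧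
      finrank ℝ A.range ≤ finrank ℝ L.range) {v : E} (hv : L v = 0) :
    ∃ γ : ℝ → N, IsCurveWithVelocity γ p v ∧ ∀ t, φ (γ t) = φ p := by
  obtain ⟨hUo, hf⟩ := contDiffOn_writtenInExtChartAt hφ p
  set f := writtenInExtChartAt 𝓘(ℝ, E) 𝓘(ℝ, F) p φ with hfdef
  set U := (extChartAt 𝓘(ℝ, E) p).target ∩
      (extChartAt 𝓘(ℝ, E) p).symm ⁻¹' (φ ⁻¹' (extChartAt 𝓘(ℝ, F) (φ p)).source)
  set x₀ := extChartAt 𝓘(ℝ, E) p p with hx₀def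
  have hx₀ : x₀ ∈ U := ⟨mem_extChartAt_target p, by simp [x₀]⟩
  have hLf : HasFDerivAt f L x₀ := by
    have h := hL.2
    rw [ModelWithCorners.range_eq_univ] at h
    exact hasFDerivWithinAt_univ.1 h
  obtain ⟨Q, e, W, W', hQ, hWo, hWo', hWc, hWc', hQW, h0W', hWW, hxe, heU, hex, he1, hes, hconst,
    hder⟩ := constant_rank hUo hx₀ hf hLf fun x hx => by
      obtain ⟨A, hA, hAr⟩ := hr ((extChartAt 𝓘(ℝ, E) p).symm x)
      exact (finrank_range_fderiv_writtenInExtChartAt_le p hx hA).trans hAr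
  -- The curve runs along the kernel direction of the adapted coordinates, where `f` is constant.
  let n : L.ker := ⟨v, hv⟩
  have hcn : Continuous fun t : ℝ => t • n := by fun_prop
  obtain ⟨δ, hδ, hδW⟩ := Metric.mem_nhds_iff.1
    ((hWo'.preimage hcn).mem_nhds (show (0 : ℝ) ∈ _ by simpa using h0W'))
  have hc0 : e.symm (Q (f x₀), (0 : ℝ) • n) = x₀ := by rw [zero_smul, ← hex, e.left_inv hxe]
  obtain ⟨γ, hγ, hγt⟩ := exists_isCurveWithVelocity (N := N)
    (c := fun t : ℝ => e.symm (Q (f x₀), t • n)) hc0 hδ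
    (hes.comp (contDiff_const.prodMk (contDiff_id.smul contDiff_const)).contDiffOn
      fun t ht => hWW ⟨hQW, hδW ht⟩)
    (fun t ht => heU (e.map_target (hWW ⟨hQW, hδW ht⟩))) (hder n)
    ((contMDiffOn_extChartAt_symm p).mono inter_subset_left)
    (hasMFDerivAt_extChartAt_symm_self N p)
  rw [hx₀def, extChartAt_to_inv] at hγ
  refine ⟨γ, hγ, fun t => ?_⟩
  obtain ⟨τ, hτ, hγτ⟩ := hγt t
  have hU : e.symm (Q (f x₀), τ • n) ∈ U := heU (e.map_target (hWW ⟨hQW, hδW hτ⟩))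
  have h1 : f (e.symm (Q (f x₀), τ • n)) = f x₀ := by
    rw [hconst _ hQW _ (hδW hτ), ← hex, e.left_inv hxe]
  rw [hγτ]
  refine (extChartAt 𝓘(ℝ, F) (φ p)).injOn hU.2 (mem_extChartAt_source _) ?_
  refine h1.trans ?_
  simp [hfdef, writtenInExtChartAt, hx₀def]

variable [FiniteDimensional ℝ F] in
/-- A submersion has smooth local sections. -/
theorem exists_local_section (hφ : ContMDiff 𝓘(ℝ, E) 𝓘(ℝ, F) ∞ φ)
    (hL : HasMFDerivAt 𝓘(ℝ, E) 𝓘(ℝ, F) φ p L) (hs : Function.Surjective L) :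
    ∃ (V : Set M) (s : M → N), IsOpen V ∧ φ p ∈ V ∧ ContMDiffOn 𝓘(ℝ, F) 𝓘(ℝ, E) ∞ s V ∧
      s (φ p) = p ∧ ∀ y ∈ V, φ (s y) = y := by
  obtain ⟨hUo, hf⟩ := contDiffOn_writtenInExtChartAt hφ p
  set f := writtenInExtChartAt 𝓘(ℝ, E) 𝓘(ℝ, F) p φ with hfdef
  set U := (extChartAt 𝓘(ℝ, E) p).target ∩
      (extChartAt 𝓘(ℝ, E) p).symm ⁻¹' (φ ⁻¹' (extChartAt 𝓘(ℝ, F) (φ p)).source)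
  set x₀ := extChartAt 𝓘(ℝ, E) p p with hx₀def
  have hx₀ : x₀ ∈ U := ⟨mem_extChartAt_target p, by simp [x₀]⟩
  have hLf : HasFDerivAt f L x₀ := by
    have h := hL.2
    rw [ModelWithCorners.range_eq_univ] at h
    exact hasFDerivWithinAt_univ.1 h
  -- Surjectivity makes the rank bound automatic and turns `Q` into the identity of `F`. The first
  -- adapted coordinate is then `f` itself, and the slice `y ↦ e.symm (y, 0)` is a section.
  have htop : L.range = ⊤ := LinearMap.range_eq_top.2 hs
  obtain ⟨Q, e, W, W', hQ, hWo, hWo', hWc, hWc', hQW, h0W', hWW, hxe, heU, hex, he1, hes, -,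
    -⟩ := constant_rank hUo hx₀ hf hLf fun x hx => by
      rw [htop, finrank_top]; exact Submodule.finrank_le _
  have hQ' : ∀ y : F, (Q y : F) = y := fun y => by
    have := hQ ⟨y, htop ▸ Submodule.mem_top⟩
    exact congrArg Subtype.val this
  have hfx : f x₀ = extChartAt 𝓘(ℝ, F) (φ p) (φ p) := by
    simp [hfdef, writtenInExtChartAt, hx₀def]
  refine ⟨(extChartAt 𝓘(ℝ, F) (φ p)).source ∩ extChartAt 𝓘(ℝ, F) (φ p) ⁻¹' (Q ⁻¹' W),
    fun y => (extChartAt 𝓘(ℝ, E) p).symm (e.symm (Q (extChartAt 𝓘(ℝ, F) (φ p) y), 0)),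
    (continuousOn_extChartAt _).isOpen_inter_preimage (isOpen_extChartAt_source _)
      (hWo.preimage Q.continuous), ⟨mem_extChartAt_source _, ?_⟩, ?_, ?_, ?_⟩
  · change Q _ ∈ W
    rw [← hfx]; exact hQW
  · have h1 : ContDiffOn ℝ ∞ (fun z : F => e.symm (Q z, 0)) (Q ⁻¹' W) :=
      hes.comp (Q.contDiff.prodMk contDiff_const).contDiffOn fun z hz => hWW ⟨hz, h0W'⟩
    exact (contMDiffOn_extChartAt_symm p).comp
      (h1.contMDiffOn.comp ((contMDiffOn_extChartAt (x := φ p)).mono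
        fun y hy => by simpa using hy.1)
        fun y hy => hy.2) fun y hy => (heU (e.map_target
          (hWW (a := (Q (extChartAt 𝓘(ℝ, F) (φ p) y), 0)) ⟨hy.2, h0W'⟩))).1
  · simp only
    rw [← hfx, ← hex, e.left_inv hxe]
    exact extChartAt_to_inv p
  · intro y hy
    have ht : (Q (extChartAt 𝓘(ℝ, F) (φ p) y), (0 : L.ker)) ∈ e.target := hWW ⟨hy.2, h0W'⟩
    have hU := heU (e.map_target ht)
    refine (extChartAt 𝓘(ℝ, F) (φ p)).injOn hU.2 hy.1 ?_
    change f (e.symm (Q (extChartAt 𝓘(ℝ, F) (φ p) y), 0)) = _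
    have h2 := he1 (e.symm (Q (extChartAt 𝓘(ℝ, F) (φ p) y), 0))
    rw [e.right_inv ht] at h2
    rw [← hQ' (f _), ← h2, hQ']

end ConstantRankManifold

/-! ### The infinitesimal action: Maurer--Cartan form, differential of the orbit map and its kernel.
-/

section Action

open Set Filter Topology Module

variable {EG : Type*} [NormedAddCommGroup EG] [NormedSpace ℝ EG]
  {G : Type*} [TopologicalSpace G] [ChartedSpace EG G] [Group G] [LieGroup 𝓘(ℝ, EG) ∞ G]

theorem hasMFDerivAt_maurerCartan (g h : G) (hh : h = g) :
    HasMFDerivAt 𝓘(ℝ, EG) 𝓘(ℝ, EG) (fun x : G => g⁻¹ * x) h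
      (maurerCartan (EG := EG) g : EG →L[ℝ] EG) := by
  subst hh
  exact (mdifferentiable_mul_left _ _).hasMFDerivAt

variable (EG) in
/-- The differential at `1` of left translation by `g`. -/
def leftDeriv (g : G) : EG →L[ℝ] EG :=
  mfderiv 𝓘(ℝ, EG) 𝓘(ℝ, EG) (fun h : G => g * h) 1

theorem hasMFDerivAt_leftDeriv (g h : G) (hh : h = 1) :
    HasMFDerivAt 𝓘(ℝ, EG) 𝓘(ℝ, EG) (fun x : G => g * x) h (leftDeriv EG g) := by
  subst hh
  exact (mdifferentiable_mul_left _ _).hasMFDerivAt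

theorem maurerCartan_leftDeriv (g : G) (v : EG) :
    (maurerCartan (EG := EG) g : EG →L[ℝ] EG) (leftDeriv EG g v) = v := by
  have h := (hasMFDerivAt_maurerCartan (EG := EG) g (g * 1) (mul_one g)).comp 1
    (hasMFDerivAt_leftDeriv g 1 rfl)
  have e : ((fun x : G => g⁻¹ * x) ∘ fun x => g * x) = id := by ext; simp
  rw [e] at h
  exact congrArg (fun L : EG →L[ℝ] EG => L v) (hasMFDerivAt_unique h (hasMFDerivAt_id 1))

theorem maurerCartan_mul_left (a g : G) (v : EG) :
    (maurerCartan (EG := EG) (a * g) : EG →L[ℝ] EG)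
      (mfderiv 𝓘(ℝ, EG) 𝓘(ℝ, EG) (fun h : G => a * h) g v : EG)
      = (maurerCartan (EG := EG) g : EG →L[ℝ] EG) v := by
  have h := (hasMFDerivAt_maurerCartan (EG := EG) (a * g) (a * g) rfl).comp g
    (mdifferentiable_mul_left a g).hasMFDerivAt
  have e : ((fun x : G => (a * g)⁻¹ * x) ∘ fun x => a * x) = fun x => g⁻¹ * x := by
    ext; simp [mul_assoc]
  rw [e] at h
  exact congrArg (fun L : EG →L[ℝ] EG => L v)
    (hasMFDerivAt_unique h (hasMFDerivAt_maurerCartan g g rfl))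

/-- Differentiate `(g k)⁻¹ (x k) = k⁻¹ (g⁻¹ x) k` in `x` at `g`. This is the source of the
`K`-equivariance of the connection. -/
theorem maurerCartan_mul_right (g k : G) (v : EG) :
    (maurerCartan (EG := EG) (g * k) : EG →L[ℝ] EG)
      (mfderiv 𝓘(ℝ, EG) 𝓘(ℝ, EG) (fun h : G => h * k) g v : EG)
      = Ad EG k⁻¹ ((maurerCartan (EG := EG) g : EG →L[ℝ] EG) v) := by
  have hd : MDifferentiable 𝓘(ℝ, EG) 𝓘(ℝ, EG) (fun h : G => h * k) :=
    (contMDiff_mul_right (I := 𝓘(ℝ, EG)) (n := ∞) (a := k)).mdifferentiable (by simp)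
  have h := (hasMFDerivAt_maurerCartan (EG := EG) (g * k) (g * k) rfl).comp g
    (hd g).hasMFDerivAt
  have h' := (hasMFDerivAt_conj (EG := EG) k⁻¹ (g⁻¹ * g) (inv_mul_cancel g)).comp g
    (hasMFDerivAt_maurerCartan g g rfl)
  have e : ((fun x : G => (g * k)⁻¹ * x) ∘ fun x => x * k)
      = ((fun h : G => k⁻¹ * h * k⁻¹⁻¹) ∘ fun x => g⁻¹ * x) := by
    ext; simp [mul_assoc]
  rw [e] at h
  exact congrArg (fun L : EG →L[ℝ] EG => L v) (hasMFDerivAt_unique h h')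

variable {EM : Type*} [NormedAddCommGroup EM] [NormedSpace ℝ EM]
  {M : Type*} [TopologicalSpace M] [ChartedSpace EM M] [MulAction G M]
  [ContMDiffSMul 𝓘(ℝ, EG) 𝓘(ℝ, EM) ∞ G M] {p₀ : M}

variable (EG EM) in
/-- The differential at `1` of `h ↦ (g h) • p₀`. -/
def orbitDeriv (p₀ : M) (g : G) : EG →L[ℝ] EM :=
  mfderiv 𝓘(ℝ, EG) 𝓘(ℝ, EM) (fun h : G => (g * h) • p₀) 1

variable (EG EM) in
omit [LieGroup 𝓘(ℝ, EG) ∞ G] in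
theorem contMDiff_orbit (p₀ : M) : ContMDiff 𝓘(ℝ, EG) 𝓘(ℝ, EM) ∞ (fun g : G => g • p₀) :=
  (contMDiff_smul (I := 𝓘(ℝ, EG)) (I' := 𝓘(ℝ, EM)) (n := ∞)).comp
    (contMDiff_id.prodMk contMDiff_const)

variable (EG) in
omit [LieGroup 𝓘(ℝ, EG) ∞ G] in
include EG in
theorem mdifferentiable_const_smul (a : G) :
    MDifferentiable 𝓘(ℝ, EM) 𝓘(ℝ, EM) (fun y : M => a • y) :=
  (ContMDiffSMul.contMDiff_const_smul (I := 𝓘(ℝ, EG)) (I' := 𝓘(ℝ, EM)) (n := ∞)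
    a).mdifferentiable (by simp)

theorem hasMFDerivAt_orbitDeriv (p₀ : M) (g h : G) (hh : h = 1) :
    HasMFDerivAt 𝓘(ℝ, EG) 𝓘(ℝ, EM) (fun x : G => (g * x) • p₀) h (orbitDeriv EG EM p₀ g) := by
  subst hh
  exact (((contMDiff_orbit EG EM p₀).comp (contMDiff_mul_left (I := 𝓘(ℝ, EG)) (n := ∞)
    (a := g))).mdifferentiable (by simp) 1).hasMFDerivAt

theorem hasMFDerivAt_orbit (p₀ : M) (g : G) :
    HasMFDerivAt 𝓘(ℝ, EG) 𝓘(ℝ, EM) (fun x : G => x • p₀) g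
      ((orbitDeriv EG EM p₀ g).comp (maurerCartan (EG := EG) g : EG →L[ℝ] EG)) := by
  have h := (hasMFDerivAt_orbitDeriv (EG := EG) (EM := EM) p₀ g (g⁻¹ * g) (inv_mul_cancel g)).comp
    g (hasMFDerivAt_maurerCartan g g rfl)
  have e : ((fun x : G => (g * x) • p₀) ∘ fun x => g⁻¹ * x) = fun x => x • p₀ := by
    ext; simp
  rw [e] at h
  exact h

theorem mfderiv_smul_orbitDeriv (a g : G) {y : M} (hy : y = g • p₀) (v : EG) :
    (mfderiv 𝓘(ℝ, EM) 𝓘(ℝ, EM) (fun y : M => a • y) y (orbitDeriv EG EM p₀ g v : EM) : EM)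
      = orbitDeriv EG EM p₀ (a * g) v := by
  have h0 : HasMFDerivAt 𝓘(ℝ, EM) 𝓘(ℝ, EM) (fun y : M => a • y) ((g * 1) • p₀)
      (mfderiv 𝓘(ℝ, EM) 𝓘(ℝ, EM) (fun y : M => a • y) y : EM →L[ℝ] EM) := by
    rw [mul_one, ← hy]
    exact (mdifferentiable_const_smul EG a y).hasMFDerivAt
  have h := h0.comp 1 (hasMFDerivAt_orbitDeriv (EG := EG) p₀ g 1 rfl)
  have e : ((fun y : M => a • y) ∘ fun x : G => (g * x) • p₀) = fun x => (a * g * x) • p₀ := by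
    ext; simp [mul_smul]
  rw [e] at h
  exact congrArg (fun L : EG →L[ℝ] EM => L v)
    (hasMFDerivAt_unique h (hasMFDerivAt_orbitDeriv p₀ (a * g) 1 rfl))

/-- Since `k⁻¹` fixes `p₀`, one has `g k x p₀ = g (k x k⁻¹) p₀`. This makes `[g, v] ↦ orbitDeriv g
v` independent of the representative. -/
theorem orbitDeriv_mul_stabilizer (g : G) {k : G} (hk : k ∈ MulAction.stabilizer G p₀) (v : EG) :
    orbitDeriv EG EM p₀ (g * k) v = orbitDeriv EG EM p₀ g (Ad EG k v) := by
  have h := (hasMFDerivAt_orbitDeriv (EG := EG) (EM := EM) p₀ g (k * 1 * k⁻¹) (by simp)).comp 1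
    (hasMFDerivAt_conj k 1 rfl)
  have hk' : k⁻¹ • p₀ = p₀ := inv_smul_eq_iff.2 hk.symm
  have e : ((fun x : G => (g * x) • p₀) ∘ fun x => k * x * k⁻¹) = fun x => (g * k * x) • p₀ := by
    ext; simp [mul_smul, hk']
  rw [e] at h
  exact congrArg (fun L : EG →L[ℝ] EM => L v)
    (hasMFDerivAt_unique (hasMFDerivAt_orbitDeriv p₀ (g * k) 1 rfl) h)

theorem orbitDeriv_eq_zero_iff (g : G) (v : EG) :
    orbitDeriv EG EM p₀ g v = 0 ↔ orbitDeriv EG EM p₀ (1 : G) v = 0 := by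
  have h : ∀ a b : G, orbitDeriv EG EM p₀ b v = 0 → orbitDeriv EG EM p₀ (a * b) v = 0 := by
    intro a b hb
    rw [← mfderiv_smul_orbitDeriv a b rfl v, hb]
    exact map_zero (mfderiv 𝓘(ℝ, EM) 𝓘(ℝ, EM) (fun y : M => a • y) (b • p₀))
  exact ⟨fun hg => by simpa using h g⁻¹ g hg, fun h1 => by simpa using h g 1 h1⟩

theorem orbitDeriv_of_mem_lieAlg (g : G) {v : EG}
    (hv : v ∈ lieAlg EG (MulAction.stabilizer G p₀)) : orbitDeriv EG EM p₀ g v = 0 := by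
  obtain ⟨γ, hγK, hγ, hγ0, rfl⟩ := hv
  have h1 := ((hγ.mdifferentiable (by simp)) 0).hasMFDerivAt
  have h := (hasMFDerivAt_orbitDeriv (EG := EG) (EM := EM) p₀ g (γ 0) hγ0).comp (0 : ℝ) h1
  have e : ((fun x : G => (g * x) • p₀) ∘ γ) = fun _ => g • p₀ := by
    ext t
    simp only [Function.comp, mul_smul]
    rw [hγK t]
  rw [e] at h
  exact congrArg (fun L : ℝ →L[ℝ] EM => L 1) (hasMFDerivAt_unique h (hasMFDerivAt_const _ _))

section Submersion

variable [FiniteDimensional ℝ EG]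

/-- The range at `g` is the image of the range at `1` under the differential of `y ↦ g • y`, so the
orbit map satisfies the rank bound relative to the point `1`. -/
theorem finrank_range_orbitDeriv (g : G) :
    finrank ℝ ((orbitDeriv EG EM p₀ g).comp (maurerCartan (EG := EG) g : EG →L[ℝ] EG)).range
      ≤ finrank ℝ ((orbitDeriv EG EM p₀ (1 : G)).comp
        (maurerCartan (EG := EG) (1 : G) : EG →L[ℝ] EG)).range := by
  have h0 : ∀ g : G, Function.Surjective (maurerCartan (EG := EG) g : EG →L[ℝ] EG) :=
    fun g v => ⟨_, maurerCartan_leftDeriv g v⟩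
  have h1 : ∀ g : G, ((orbitDeriv EG EM p₀ g).comp
      (maurerCartan (EG := EG) g : EG →L[ℝ] EG)).range = (orbitDeriv EG EM p₀ g).range := by
    intro g
    ext w
    constructor
    · rintro ⟨v, rfl⟩
      exact LinearMap.mem_range_self _ _
    · rintro ⟨v, rfl⟩
      obtain ⟨u, rfl⟩ := h0 g v
      exact ⟨u, rfl⟩
  rw [h1, h1]
  let A : EM →L[ℝ] EM := mfderiv 𝓘(ℝ, EM) 𝓘(ℝ, EM) (fun y : M => g • y) p₀
  have h2 : (orbitDeriv EG EM p₀ g).range ≤ (orbitDeriv EG EM p₀ (1 : G)).range.map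
      (A : EM →ₗ[ℝ] EM) := by
    rintro _ ⟨v, rfl⟩
    refine ⟨orbitDeriv EG EM p₀ 1 v, LinearMap.mem_range_self _ _, ?_⟩
    have := mfderiv_smul_orbitDeriv (EM := EM) g 1 (one_smul G p₀).symm v
    rw [mul_one] at this
    exact this
  exact (Submodule.finrank_mono h2).trans (Submodule.finrank_map_le _ _)

variable [IsManifold 𝓘(ℝ, EM) ∞ M]

/-- The stabilizer is the fibre of the orbit map through `1`. Constant rank makes every kernel
vector at `1` the velocity of a curve in that fibre, which is what membership in `lieAlg` asks for.
-/
theorem mem_lieAlg_iff_orbitDeriv (g : G) (v : EG) :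
    v ∈ lieAlg EG (MulAction.stabilizer G p₀) ↔ orbitDeriv EG EM p₀ g v = 0 := by
  refine ⟨orbitDeriv_of_mem_lieAlg g, fun hv => ?_⟩
  rw [orbitDeriv_eq_zero_iff] at hv
  have hm : ∀ v, (maurerCartan (EG := EG) (1 : G) : EG →L[ℝ] EG) v = v := by
    intro v
    have h := hasMFDerivAt_maurerCartan (EG := EG) (1 : G) 1 rfl
    have e : (fun x : G => 1⁻¹ * x) = id := by ext; simp
    rw [e] at h
    exact congrArg (fun L : EG →L[ℝ] EG => L v) (hasMFDerivAt_unique h (hasMFDerivAt_id 1))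
  obtain ⟨γ, hγ, hγt⟩ := exists_curve_in_fibre_of_constant_rank (contMDiff_orbit EG EM p₀)
    (hasMFDerivAt_orbit p₀ (1 : G))
    (fun g => ⟨_, hasMFDerivAt_orbit p₀ g, finrank_range_orbitDeriv g⟩)
    (v := v) ((congrArg (orbitDeriv EG EM p₀ (1 : G)) (hm v)).trans hv)
  exact ⟨γ, fun t => by simpa using hγt t, hγ⟩

variable [FiniteDimensional ℝ EM] [SecondCountableTopology G] [T2Space M]
  [MulAction.IsPretransitive G M]

-- This is the open mapping theorem for transitive actions: `G` is σ-compact, being locally compact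
-- and second countable, and `M` is locally compact Hausdorff, hence a Baire space.
variable (EG EM) in
omit [IsManifold 𝓘(ℝ, EM) ∞ M] in
include EG EM in
theorem isOpenMap_orbit (p₀ : M) : IsOpenMap (fun g : G => g • p₀) := by
  have := topologicalGroup_of_lieGroup 𝓘(ℝ, EG) ∞ (G := G)
  have := ContMDiffSMul.continuousSMul (I := 𝓘(ℝ, EG)) (I' := 𝓘(ℝ, EM)) (G := G) (M := M) ∞
  have := ChartedSpace.locallyCompactSpace EG G
  have := ChartedSpace.locallyCompactSpace EM M
  exact isOpenMap_smul_of_sigmaCompact p₀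

-- At `1` the orbit map is open of constant rank, hence a submersion; translation by `g` carries
-- this to every other point.
variable (EM) in
theorem surjective_orbitDeriv (g : G) : Function.Surjective (orbitDeriv EG EM p₀ g) := by
  have h1 : Function.Surjective (orbitDeriv EG EM p₀ (1 : G)) := by
    have h := surjective_of_isOpenMap_of_constant_rank (contMDiff_orbit EG EM p₀)
      (hasMFDerivAt_orbit p₀ (1 : G))
      (fun g => ⟨_, hasMFDerivAt_orbit p₀ g, finrank_range_orbitDeriv g⟩) (isOpenMap_orbit EG EM p₀)
    intro w
    obtain ⟨v, hv⟩ := h w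
    exact ⟨_, hv⟩
  intro w
  obtain ⟨v, hv⟩ := h1 (mfderiv 𝓘(ℝ, EM) 𝓘(ℝ, EM) (fun y : M => g⁻¹ • y) (g • p₀) w : EM)
  refine ⟨v, ?_⟩
  have h2 := mfderiv_smul_orbitDeriv (EM := EM) g 1 (one_smul G p₀).symm v
  rw [mul_one] at h2
  rw [← h2, hv]
  have h0 : HasMFDerivAt 𝓘(ℝ, EM) 𝓘(ℝ, EM) (fun y : M => g • y) (g⁻¹ • g • p₀)
      (mfderiv 𝓘(ℝ, EM) 𝓘(ℝ, EM) (fun y : M => g • y) p₀ : EM →L[ℝ] EM) := by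
    rw [inv_smul_smul]
    exact (mdifferentiable_const_smul EG g p₀).hasMFDerivAt
  have h3 := h0.comp (g • p₀) (mdifferentiable_const_smul EG g⁻¹ (g • p₀)).hasMFDerivAt
  have e : ((fun y : M => g • y) ∘ fun y => g⁻¹ • y) = id := by ext; simp
  rw [e] at h3
  exact congrArg (fun L : EM →L[ℝ] EM => L w) (hasMFDerivAt_unique h3 (hasMFDerivAt_id _))

variable (EG EM) in
/-- The orbit map has smooth local sections. -/
theorem exists_orbit_section (p₀ : M) (g : G) :
    ∃ (V : Set M) (s : M → G), IsOpen V ∧ g • p₀ ∈ V ∧ ContMDiffOn 𝓘(ℝ, EM) 𝓘(ℝ, EG) ∞ s V ∧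
      s (g • p₀) = g ∧ ∀ y ∈ V, s y • p₀ = y := by
  refine exists_local_section (contMDiff_orbit EG EM p₀) (hasMFDerivAt_orbit p₀ g) ?_
  exact (surjective_orbitDeriv EM g).comp fun v => ⟨_, maurerCartan_leftDeriv g v⟩

end Submersion

end Action

/-! ### Smooth dependence of partial differentials on parameters. -/

section TangentSmooth

variable {EN : Type*} [NormedAddCommGroup EN] [NormedSpace ℝ EN]
  {N : Type*} [TopologicalSpace N] [ChartedSpace EN N]
  {EP : Type*} [NormedAddCommGroup EP] [NormedSpace ℝ EP]
  {P : Type*} [TopologicalSpace P] [ChartedSpace EP P]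
  {EQ : Type*} [NormedAddCommGroup EQ] [NormedSpace ℝ EQ]
  {Q : Type*} [TopologicalSpace Q] [ChartedSpace EQ Q]

/-- Every tangent space of `P` is the same model space `EP`, so a vector can be kept when its base
point is replaced by an equal one, for instance `g⁻¹ g` by `1`. -/
theorem tangentBundle_mk_congr {p q : P} (h : p = q) (v : EP) :
    (⟨p, v⟩ : TangentBundle 𝓘(ℝ, EP) P) = ⟨q, v⟩ := by
  subst h; rfl

variable [IsManifold 𝓘(ℝ, EP) ∞ P]

theorem tangentBundle_trivializationAt_self (p : P) (v : EP) :
    (trivializationAt EP (TangentSpace 𝓘(ℝ, EP) : P → Type _) p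
      (⟨p, v⟩ : TangentBundle 𝓘(ℝ, EP) P)).2 = v :=
  tangentCoordChange_self (I := 𝓘(ℝ, EP)) (x := p) (z := p) (mem_extChartAt_source p)

/-- The inclusion of a tangent space in the tangent bundle is smooth. -/
theorem contMDiff_tangentBundle_mk (p : P) :
    ContMDiff 𝓘(ℝ, EP) 𝓘(ℝ, EP).tangent ∞
      (fun v : EP => (⟨p, v⟩ : TangentBundle 𝓘(ℝ, EP) P)) := by
  intro v
  rw [contMDiffAt_totalSpace]
  refine ⟨contMDiffAt_const, ?_⟩
  simp only [tangentBundle_trivializationAt_self]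
  exact contMDiffAt_id

/-- A smooth family of tangent vectors at a fixed point is smooth as a family of vectors. -/
theorem contMDiff_of_tangentBundle_mk {H : Type*} [TopologicalSpace H] {I : ModelWithCorners ℝ EN H}
    {N : Type*} [TopologicalSpace N] [ChartedSpace H N] (p : P) {f : N → EP}
    (hf : ContMDiff I 𝓘(ℝ, EP).tangent ∞
      (fun n => (⟨p, f n⟩ : TangentBundle 𝓘(ℝ, EP) P))) :
    ContMDiff I 𝓘(ℝ, EP) ∞ f := by
  intro n
  have h := contMDiffAt_totalSpace.1 (hf n)
  simp only [tangentBundle_trivializationAt_self] at h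
  exact h.2

/-- The partial differential of a smooth map of two variables is smooth. -/
theorem contMDiff_mfderiv_snd [IsManifold 𝓘(ℝ, EN) ∞ N] [IsManifold 𝓘(ℝ, EQ) ∞ Q] {μ : N × P → Q}
    (hμ : ContMDiff (𝓘(ℝ, EN).prod 𝓘(ℝ, EP)) 𝓘(ℝ, EQ) ∞ μ) :
    ContMDiff (𝓘(ℝ, EN).prod 𝓘(ℝ, EP).tangent) 𝓘(ℝ, EQ).tangent ∞
      (fun a : N × TangentBundle 𝓘(ℝ, EP) P => (⟨μ (a.1, a.2.1),
        mfderiv 𝓘(ℝ, EP) 𝓘(ℝ, EQ) (fun y => μ (a.1, y)) a.2.1 a.2.2⟩ :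
          TangentBundle 𝓘(ℝ, EQ) Q)) := by
  have h0 : ContMDiff 𝓘(ℝ, EN) 𝓘(ℝ, EN).tangent ∞
      (fun n : N => (⟨n, 0⟩ : TangentBundle 𝓘(ℝ, EN) N)) := contMDiff_zeroSection _ _
  have h1 : ContMDiff (𝓘(ℝ, EN).prod 𝓘(ℝ, EP).tangent) (𝓘(ℝ, EN).tangent.prod 𝓘(ℝ, EP).tangent) ∞
      (fun a : N × TangentBundle 𝓘(ℝ, EP) P => ((⟨a.1, 0⟩ : TangentBundle 𝓘(ℝ, EN) N), a.2)) :=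
    (h0.comp contMDiff_fst).prodMk contMDiff_snd
  -- The partial differential in the second variable is the full tangent map of `μ` evaluated on
  -- pairs whose first component lies in the zero section.
  have h2 := (hμ.contMDiff_tangentMap (m := ∞) (by simp)).comp
    (contMDiff_equivTangentBundleProd_symm.comp h1)
  convert h2 using 1
  ext a
  · rfl
  · have hd : MDifferentiableAt (𝓘(ℝ, EN).prod 𝓘(ℝ, EP)) 𝓘(ℝ, EQ) μ (a.1, a.2.1) :=
      hμ.mdifferentiable (by simp) _
    refine heq_of_eq (Eq.trans ?_ (mfderiv_prod_eq_add_apply hd).symm)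
    have h4 : (mfderiv 𝓘(ℝ, EN) 𝓘(ℝ, EQ) (fun z => μ (z, a.2.1)) a.1 (0 : EN) : EQ) = 0 :=
      map_zero (mfderiv 𝓘(ℝ, EN) 𝓘(ℝ, EQ) (fun z => μ (z, a.2.1)) a.1)
    let B : EQ := mfderiv 𝓘(ℝ, EP) 𝓘(ℝ, EQ) (fun y => μ (a.1, y)) a.2.1 a.2.2
    exact (zero_add B).symm.trans (congrArg (fun w : EQ => w + B) h4.symm)

end TangentSmooth

/-! ### Smoothness of the Maurer--Cartan form, of `Ad` and of the infinitesimal action. -/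

section GroupSmooth

variable {EG : Type*} [NormedAddCommGroup EG] [NormedSpace ℝ EG]
  {G : Type*} [TopologicalSpace G] [ChartedSpace EG G] [Group G] [LieGroup 𝓘(ℝ, EG) ∞ G]

-- The form is the partial differential of `(a, b) ↦ a⁻¹ b` in `b` on the diagonal. Its values all
-- lie over the point `1`, so smoothness in the tangent bundle is smoothness as a map to `𝔤`.
variable (EG G) in
theorem contMDiff_maurerCartan : ContMDiff 𝓘(ℝ, EG).tangent 𝓘(ℝ, EG) ∞
    (fun z : TangentBundle 𝓘(ℝ, EG) G => (maurerCartan z.1 z.2 : EG)) := by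
  refine contMDiff_of_tangentBundle_mk (1 : G) ?_
  have hμ : ContMDiff (𝓘(ℝ, EG).prod 𝓘(ℝ, EG)) 𝓘(ℝ, EG) ∞ (fun a : G × G => a.1⁻¹ * a.2) :=
    contMDiff_fst.inv.mul contMDiff_snd
  have h := (contMDiff_mfderiv_snd hμ).comp
    ((contMDiff_proj (TangentSpace 𝓘(ℝ, EG) : G → Type _)).prodMk contMDiff_id)
  convert h using 1
  ext1 z
  exact tangentBundle_mk_congr (inv_mul_cancel z.1).symm _

variable (EG G) in
theorem contMDiff_Ad : ContMDiff (𝓘(ℝ, EG).prod 𝓘(ℝ, EG)) 𝓘(ℝ, EG) ∞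
    (fun z : G × EG => Ad EG z.1 z.2) := by
  refine contMDiff_of_tangentBundle_mk (1 : G) ?_
  have hμ : ContMDiff (𝓘(ℝ, EG).prod 𝓘(ℝ, EG)) 𝓘(ℝ, EG) ∞
      (fun a : G × G => a.1 * a.2 * a.1⁻¹) :=
    (contMDiff_fst.mul contMDiff_snd).mul contMDiff_fst.inv
  have h := (contMDiff_mfderiv_snd hμ).comp (contMDiff_fst.prodMk
    ((contMDiff_tangentBundle_mk (1 : G)).comp contMDiff_snd))
  convert h using 1
  ext1 z
  exact tangentBundle_mk_congr (by simp) _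

variable {EM : Type*} [NormedAddCommGroup EM] [NormedSpace ℝ EM]
  {M : Type*} [TopologicalSpace M] [ChartedSpace EM M] [MulAction G M]
  [ContMDiffSMul 𝓘(ℝ, EG) 𝓘(ℝ, EM) ∞ G M] [IsManifold 𝓘(ℝ, EM) ∞ M]

variable (EG G EM) in
theorem contMDiff_orbitDeriv (p₀ : M) : ContMDiff (𝓘(ℝ, EG).prod 𝓘(ℝ, EG)) 𝓘(ℝ, EM).tangent ∞
    (fun z : G × EG => (⟨z.1 • p₀, orbitDeriv EG EM p₀ z.1 z.2⟩ : TangentBundle 𝓘(ℝ, EM) M)) := by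
  have hμ : ContMDiff (𝓘(ℝ, EG).prod 𝓘(ℝ, EG)) 𝓘(ℝ, EM) ∞ (fun a : G × G => (a.1 * a.2) • p₀) :=
    (contMDiff_orbit EG EM p₀).comp (contMDiff_fst.mul contMDiff_snd)
  have h := (contMDiff_mfderiv_snd hμ).comp (contMDiff_fst.prodMk
    ((contMDiff_tangentBundle_mk (1 : G)).comp contMDiff_snd))
  convert h using 1
  ext1 z
  exact tangentBundle_mk_congr (by simp) _

end GroupSmooth

/-! ### The smooth vector bundle structure of `G ×_K 𝔪`. -/

section AssocBundle

open Set Filter Topology Module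

variable {EG : Type*} [NormedAddCommGroup EG] [NormedSpace ℝ EG]
  {G : Type*} [TopologicalSpace G] [ChartedSpace EG G] [Group G] [LieGroup 𝓘(ℝ, EG) ∞ G]
  {EM : Type*} [NormedAddCommGroup EM] [NormedSpace ℝ EM]
  {M : Type*} [TopologicalSpace M] [ChartedSpace EM M] [MulAction G M]

variable (EG G EM) in
/-- A section of the orbit map `g ↦ g • p₀` that is smooth on an open set. -/
structure LocalSection (p₀ : M) where
  /-- The values of the section. -/
  toFun : ∀ y : M, OrbitFibre G p₀ y
  /-- The set on which the section is smooth. -/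
  baseSet : Set M
  isOpen_baseSet : IsOpen baseSet
  contMDiffOn : ContMDiffOn 𝓘(ℝ, EM) 𝓘(ℝ, EG) ∞ (fun y => (toFun y : G)) baseSet

omit [TopologicalSpace M] in
theorem assocMk_eq_assocQuot {p₀ : M} (D : CartanDecomposition EG (MulAction.stabilizer G p₀))
    {y : M} (g : OrbitFibre G p₀ y) (v : D.m) :
    (⟨y, Assoc.mk g v⟩ : TotalSpace D.m (Assoc D)) = assocQuot p₀ D ((g : G), v) := by
  obtain ⟨g, rfl⟩ := g
  rfl

omit [TopologicalSpace M] in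
theorem continuous_assocQuot {p₀ : M} (D : CartanDecomposition EG (MulAction.stabilizer G p₀)) :
    Continuous (assocQuot p₀ D) := continuous_coinduced_rng

theorem surjective_assocQuot {p₀ : M} (D : CartanDecomposition EG (MulAction.stabilizer G p₀)) :
    Function.Surjective (assocQuot p₀ D) := by
  rintro ⟨y, ⟨g, v⟩⟩
  exact ⟨((g : G), v), (assocMk_eq_assocQuot D g v).symm⟩

theorem isQuotientMap_assocQuot {p₀ : M}
    (D : CartanDecomposition EG (MulAction.stabilizer G p₀)) :
    IsQuotientMap (assocQuot p₀ D) :=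
  ⟨⟨rfl⟩, surjective_assocQuot D⟩

/-- Smoothness of a family of linear maps on a finite-dimensional space can be checked
pointwise. -/
theorem contMDiffOn_clm_of_apply {EN : Type*} [NormedAddCommGroup EN] [NormedSpace ℝ EN]
    {N : Type*} [TopologicalSpace N] [ChartedSpace EN N]
    {E F : Type*} [NormedAddCommGroup E] [NormedSpace ℝ E] [FiniteDimensional ℝ E]
    [NormedAddCommGroup F] [NormedSpace ℝ F] {s : Set N} {A : N → E →L[ℝ] F}
    (h : ∀ v, ContMDiffOn 𝓘(ℝ, EN) 𝓘(ℝ, F) ∞ (fun n => A n v) s) :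
    ContMDiffOn 𝓘(ℝ, EN) 𝓘(ℝ, E →L[ℝ] F) ∞ A s := by
  let b := Module.finBasis ℝ E
  have e : A = fun n => ∑ i, ContinuousLinearMap.smulRightL ℝ E F
      (LinearMap.toContinuousLinearMap (b.coord i)) (A n (b i)) := by
    ext n v
    conv_lhs => rw [← b.sum_repr v, map_sum]
    simp
  rw [e]
  refine contMDiffOn_finsetSum fun i _ => ?_
  exact (ContinuousLinearMap.contDiff _).contMDiff.comp_contMDiffOn (h (b i))

variable [MulAction.IsPretransitive G M] {p₀ : M}

omit [LieGroup 𝓘(ℝ, EG) ∞ G] in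
/-- A local section extends to a (not necessarily smooth) section over the whole space. -/
theorem LocalSection.exists_of_contMDiffOn {V : Set M} (hV : IsOpen V) {s : M → G}
    (hs : ContMDiffOn 𝓘(ℝ, EM) 𝓘(ℝ, EG) ∞ s V) (h : ∀ y ∈ V, s y • p₀ = y) :
    ∃ σ : LocalSection EG G EM p₀, σ.baseSet = V ∧ ∀ y ∈ V, (σ.toFun y : G) = s y := by
  classical
  refine ⟨⟨fun y => if hy : y ∈ V then ⟨s y, h y hy⟩ else Assoc.somePoint p₀ y, V, hV,
    hs.congr fun y hy => by simp [hy]⟩, rfl, fun y hy => by simp [hy]⟩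

variable [FiniteDimensional ℝ EG] [ContMDiffSMul 𝓘(ℝ, EG) 𝓘(ℝ, EM) ∞ G M]
  (D : CartanDecomposition EG (MulAction.stabilizer G p₀))

-- This writes the `𝔪`-valued action as a linear projection after the `𝔤`-valued `Ad`, so that its
-- smoothness follows from that of `Ad`.
omit [TopologicalSpace M] [ChartedSpace EM M] [MulAction.IsPretransitive G M]
  [FiniteDimensional ℝ EG] [ContMDiffSMul 𝓘(ℝ, EG) 𝓘(ℝ, EM) ∞ G M] in
theorem CartanDecomposition.adM_eq_projM (k : MulAction.stabilizer G p₀) (v : D.m) :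
    D.adM k v = D.projM (Ad EG (k : G) (v : EG)) :=
  (Submodule.projectionOnto_apply_left D.isCompl.symm (D.adM k v)).symm

omit [TopologicalSpace M] [ChartedSpace EM M] [MulAction.IsPretransitive G M]
  [FiniteDimensional ℝ EG] [ContMDiffSMul 𝓘(ℝ, EG) 𝓘(ℝ, EM) ∞ G M] in
theorem CartanDecomposition.projK_add_projM (v : EG) :
    (D.projK v : EG) + (D.projM v : EG) = v :=
  Submodule.projection_add_projection_eq_self D.isCompl v

-- Both summands `𝔨` and `𝔪` are stable under `Ad(K)`, hence the projection commutes with it.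
omit [TopologicalSpace M] [ChartedSpace EM M] [MulAction.IsPretransitive G M]
  [FiniteDimensional ℝ EG] [ContMDiffSMul 𝓘(ℝ, EG) 𝓘(ℝ, EM) ∞ G M] in
theorem CartanDecomposition.projK_Ad {k : G} (hk : k ∈ MulAction.stabilizer G p₀) (v : EG) :
    (D.projK (Ad EG k v) : EG) = Ad EG k (D.projK v : EG) := by
  conv_lhs => rw [← D.projK_add_projM v, map_add, map_add]
  have h1 : D.projK (Ad EG k (D.projM v : EG)) = 0 :=
    Submodule.projectionOnto_apply_right D.isCompl ⟨_, D.Ad_mem hk (D.projM v).2⟩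
  have h2 : D.projK (Ad EG k (D.projK v : EG)) = ⟨_, Ad_mem_lieAlg hk (D.projK v).2⟩ :=
    Submodule.projectionOnto_apply_left D.isCompl ⟨_, Ad_mem_lieAlg hk (D.projK v).2⟩
  rw [h1, h2, add_zero]

omit [TopologicalSpace M] [ChartedSpace EM M] [MulAction.IsPretransitive G M]
  [ContMDiffSMul 𝓘(ℝ, EG) 𝓘(ℝ, EM) ∞ G M] in
theorem CartanDecomposition.contMDiff_projM : ContMDiff 𝓘(ℝ, EG) 𝓘(ℝ, D.m) ∞ D.projM :=
  (LinearMap.toContinuousLinearMap D.projM).contDiff.contMDiff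

omit [MulAction.IsPretransitive G M] in
/-- The coordinates of `[g, v]` with respect to a local section. -/
theorem contMDiffOn_assocCoord (σ : LocalSection EG G EM p₀) :
    ContMDiffOn (𝓘(ℝ, EG).prod 𝓘(ℝ, D.m)) 𝓘(ℝ, D.m) ∞
      (fun a : G × D.m => D.adM (Assoc.diff (σ.toFun (a.1 • p₀)) ⟨a.1, rfl⟩) a.2)
      {a | a.1 • p₀ ∈ σ.baseSet} := by
  simp only [CartanDecomposition.adM_eq_projM]
  refine D.contMDiff_projM.comp_contMDiffOn ((contMDiff_Ad EG G).comp_contMDiffOn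
    (ContMDiffOn.prodMk ?_ ?_))
  · refine (ContMDiffOn.inv ?_).mul contMDiffOn_fst
    exact σ.contMDiffOn.comp ((contMDiff_orbit EG EM p₀).comp contMDiff_fst).contMDiffOn
      fun a ha => ha
  · exact (D.m.subtypeL.contDiff.contMDiff.comp contMDiff_snd).contMDiffOn

/-- The local trivialization of `G ×_K 𝔪` defined by a local section of the orbit map. -/
def assocTriv (σ : LocalSection EG G EM p₀) :
    Trivialization D.m (TotalSpace.proj : TotalSpace D.m (Assoc D) → M) where
  toFun z := (z.1, (Assoc.frame (σ.toFun z.1)).symm z.2)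
  invFun a := ⟨a.1, Assoc.frame (σ.toFun a.1) a.2⟩
  source := TotalSpace.proj ⁻¹' σ.baseSet
  target := σ.baseSet ×ˢ univ
  map_source' z hz := ⟨hz, mem_univ _⟩
  map_target' a ha := ha.1
  left_inv' z _ := by simp
  right_inv' a _ := by simp
  open_source := by
    refine (isQuotientMap_assocQuot D).isOpen_preimage.1 ?_
    exact σ.isOpen_baseSet.preimage ((contMDiff_orbit EG EM p₀).continuous.comp continuous_fst)
  open_target := σ.isOpen_baseSet.prod isOpen_univ
  continuousOn_toFun := by
    have hs : IsOpen ((TotalSpace.proj : TotalSpace D.m (Assoc D) → M) ⁻¹' σ.baseSet) := by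
      refine (isQuotientMap_assocQuot D).isOpen_preimage.1 ?_
      exact σ.isOpen_baseSet.preimage ((contMDiff_orbit EG EM p₀).continuous.comp continuous_fst)
    -- Over an open set of the quotient, continuity is tested on `G × 𝔪`, where the fibre coordinate
    -- of `[g, v]` is `Ad(σ(g p₀)⁻¹ g) v`.
    rw [(isQuotientMap_assocQuot D).continuousOn_isOpen_iff hs]
    exact ((contMDiff_orbit EG EM p₀).continuous.comp continuous_fst).continuousOn.prodMk
      (contMDiffOn_assocCoord D σ).continuousOn
  continuousOn_invFun := by
    have h : ContinuousOn (fun a : M × D.m => assocQuot p₀ D ((σ.toFun a.1 : G), a.2))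
        (σ.baseSet ×ˢ univ) :=
      (continuous_assocQuot D).comp_continuousOn ((σ.contMDiffOn.continuousOn.comp
        continuousOn_fst fun a ha => ha.1).prodMk continuousOn_snd)
    exact h.congr fun a _ => assocMk_eq_assocQuot D _ _
  baseSet := σ.baseSet
  open_baseSet := σ.isOpen_baseSet
  source_eq := rfl
  target_eq := rfl
  proj_toFun _ _ := rfl

instance (σ : LocalSection EG G EM p₀) : (assocTriv D σ).IsLinear ℝ where
  linear b _ := (Assoc.frameₗ (D := D) (σ.toFun b)).symm.toLinearMap.isLinear

theorem assocTriv_coordChangeL (σ τ : LocalSection EG G EM p₀) {y : M}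
    (hy : y ∈ σ.baseSet ∩ τ.baseSet) (v : D.m) :
    (assocTriv D σ).coordChangeL ℝ (assocTriv D τ) y v
      = D.adM (Assoc.diff (τ.toFun y) (σ.toFun y)) v := by
  rw [Trivialization.coordChangeL_apply' (assocTriv D σ) (assocTriv D τ) hy]
  rfl

theorem contMDiffOn_assocTriv_coordChangeL (σ τ : LocalSection EG G EM p₀) :
    ContMDiffOn 𝓘(ℝ, EM) 𝓘(ℝ, D.m →L[ℝ] D.m) ∞
      (fun y => ((assocTriv D σ).coordChangeL ℝ (assocTriv D τ) y : D.m →L[ℝ] D.m))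
      (σ.baseSet ∩ τ.baseSet) := by
  refine contMDiffOn_clm_of_apply fun v => ?_
  have h : ContMDiffOn 𝓘(ℝ, EM) 𝓘(ℝ, D.m) ∞
      (fun y => D.projM (Ad EG ((τ.toFun y : G)⁻¹ * σ.toFun y) (v : EG)))
      (σ.baseSet ∩ τ.baseSet) := by
    refine D.contMDiff_projM.comp_contMDiffOn ((contMDiff_Ad EG G).comp_contMDiffOn
      (ContMDiffOn.prodMk ?_ contMDiffOn_const))
    exact (τ.contMDiffOn.mono inter_subset_right).inv.mul (σ.contMDiffOn.mono inter_subset_left)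
  refine h.congr fun y hy => ?_
  refine (assocTriv_coordChangeL D σ τ hy v).trans ?_
  rw [CartanDecomposition.adM_eq_projM]
  rfl

/-- The frame `v ↦ [σ(y), v]` is continuous into the fibre with its own quotient topology. An open
set of the fibre thus becomes an open set of `𝔪`, which the trivialization extends to an open set of
the total space. -/
theorem isInducing_assoc_totalSpaceMk (σ : LocalSection EG G EM p₀) {y : M} (hy : y ∈ σ.baseSet) :
    IsInducing (TotalSpace.mk y : Assoc D y → TotalSpace D.m (Assoc D)) := by
  have hc : Continuous (TotalSpace.mk y : Assoc D y → TotalSpace D.m (Assoc D)) := by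
    refine continuous_coinduced_dom.2 ?_
    have h : Continuous fun a : OrbitFibre G p₀ y × D.m => assocQuot p₀ D ((a.1 : G), a.2) :=
      (continuous_assocQuot D).comp (by fun_prop)
    refine h.congr fun a => (assocMk_eq_assocQuot D a.1 a.2).symm
  have hf : Continuous (Assoc.frame (D := D) (σ.toFun y)) :=
    continuous_quot_mk.comp (continuous_const.prodMk continuous_id)
  refine ⟨le_antisymm hc.le_induced fun O hO => ?_⟩
  refine ⟨(assocTriv D σ).source ∩ assocTriv D σ ⁻¹'
    (univ ×ˢ (Assoc.frame (σ.toFun y) ⁻¹' O)),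
    (assocTriv D σ).toOpenPartialHomeomorph.isOpen_inter_preimage
      (isOpen_univ.prod (hO.preimage hf)), ?_⟩
  ext z
  constructor
  · rintro ⟨-, -, hz⟩
    have hz' : Assoc.frame (σ.toFun y) ((Assoc.frame (σ.toFun y)).symm z) ∈ O := hz
    rwa [Equiv.apply_symm_apply] at hz'
  · intro hz
    refine ⟨hy, mem_univ _, ?_⟩
    change Assoc.frame (σ.toFun y) ((Assoc.frame (σ.toFun y)).symm z) ∈ O
    rwa [Equiv.apply_symm_apply]

/-- The fibre bundle structure of `G ×_K 𝔪` whose atlas is given by the local sections. -/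
@[reducible] def assocFiberBundle (h : ∀ y, ∃ σ : LocalSection EG G EM p₀, y ∈ σ.baseSet) :
    FiberBundle D.m (Assoc D) where
  totalSpaceMk_isInducing' y := isInducing_assoc_totalSpaceMk D (h y).choose (h y).choose_spec
  trivializationAtlas' := range (assocTriv D (EM := EM))
  trivializationAt' y := assocTriv D (h y).choose
  mem_baseSet_trivializationAt' y := (h y).choose_spec
  trivialization_mem_atlas' _ := mem_range_self _

variable (EM) in
/-- `G ×_K 𝔪` is a smooth vector bundle, in which every smooth local section of the orbit map
defines a trivialization. -/
theorem exists_assoc_contMDiffVectorBundle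
    (h : ∀ y, ∃ σ : LocalSection EG G EM p₀, y ∈ σ.baseSet) :
    ∃ (_ : FiberBundle D.m (Assoc D)) (_ : VectorBundle ℝ D.m (Assoc D)),
      ContMDiffVectorBundle ∞ D.m (Assoc D) 𝓘(ℝ, EM) ∧
      ∀ σ : LocalSection EG G EM p₀, MemTrivializationAtlas (assocTriv D σ) := by
  let _ : FiberBundle D.m (Assoc D) := assocFiberBundle D h
  let _ : VectorBundle ℝ D.m (Assoc D) :=
    { trivialization_linear' := by
        rintro _ ⟨σ, rfl⟩
        infer_instance
      continuousOn_coordChange' := by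
        rintro _ _ ⟨σ, rfl⟩ ⟨τ, rfl⟩
        exact (contMDiffOn_assocTriv_coordChangeL D σ τ).continuousOn }
  refine ⟨inferInstance, inferInstance, ⟨?_⟩, fun σ => ⟨mem_range_self _⟩⟩
  rintro _ _ ⟨σ, rfl⟩ ⟨τ, rfl⟩
  exact contMDiffOn_assocTriv_coordChangeL D σ τ

end AssocBundle

/-! ### Descent along `G × 𝔪 → G ×_K 𝔪` and the isomorphism with `TM`. -/

section AssocSmooth

open Set Filter Topology Module

variable {EG : Type*} [NormedAddCommGroup EG] [NormedSpace ℝ EG]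
  {G : Type*} [TopologicalSpace G] [ChartedSpace EG G] [Group G] [LieGroup 𝓘(ℝ, EG) ∞ G]
  {EM : Type*} [NormedAddCommGroup EM] [NormedSpace ℝ EM]
  {M : Type*} [TopologicalSpace M] [ChartedSpace EM M] [MulAction G M]
  [MulAction.IsPretransitive G M] {p₀ : M}
  [FiniteDimensional ℝ EG] [ContMDiffSMul 𝓘(ℝ, EG) 𝓘(ℝ, EM) ∞ G M]
  (D : CartanDecomposition EG (MulAction.stabilizer G p₀))

section Descent

variable [FiberBundle D.m (Assoc D)] [VectorBundle ℝ D.m (Assoc D)]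
  [ContMDiffVectorBundle ∞ D.m (Assoc D) 𝓘(ℝ, EM)]

/-- The local section of `G × 𝔪 → G ×_K 𝔪` defined by a local section of the orbit map. -/
def assocLift (σ : LocalSection EG G EM p₀) (z : TotalSpace D.m (Assoc D)) : G × D.m :=
  ((σ.toFun z.1 : G), (assocTriv D σ z).2)

omit [FiberBundle D.m (Assoc D)] in
theorem assocQuot_assocLift (σ : LocalSection EG G EM p₀) (z : TotalSpace D.m (Assoc D)) :
    assocQuot p₀ D (assocLift D σ z) = z := by
  refine (assocMk_eq_assocQuot D (σ.toFun z.1) _).symm.trans ?_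
  change (⟨z.1, Assoc.frame (σ.toFun z.1) ((Assoc.frame (σ.toFun z.1)).symm z.2)⟩ :
    TotalSpace D.m (Assoc D)) = z
  rw [Equiv.apply_symm_apply]

omit [FiberBundle D.m (Assoc D)] in
theorem assocLift_assocQuot (σ : LocalSection EG G EM p₀) (a : G × D.m)
    (hσ : (σ.toFun (a.1 • p₀) : G) = a.1) : assocLift D σ (assocQuot p₀ D a) = a := by
  refine Prod.ext hσ ?_
  change (Assoc.frame (σ.toFun (a.1 • p₀))).symm (Assoc.mk ⟨a.1, rfl⟩ a.2) = a.2
  rw [Equiv.symm_apply_eq, show σ.toFun (a.1 • p₀) = ⟨a.1, rfl⟩ from Subtype.ext hσ]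
  rfl

theorem contMDiffOn_assocLift (H : ∀ σ : LocalSection EG G EM p₀,
    MemTrivializationAtlas (assocTriv D σ)) (σ : LocalSection EG G EM p₀) :
    ContMDiffOn (𝓘(ℝ, EM).prod 𝓘(ℝ, D.m)) (𝓘(ℝ, EG).prod 𝓘(ℝ, D.m)) ∞ (assocLift D σ)
      (TotalSpace.proj ⁻¹' σ.baseSet) := by
  have := H σ
  refine ContMDiffOn.prodMk ?_ ?_
  · exact σ.contMDiffOn.comp (contMDiff_proj (Assoc D)).contMDiffOn fun z hz => hz
  · exact contMDiff_snd.comp_contMDiffOn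
      ((assocTriv D σ).contMDiffOn (IB := 𝓘(ℝ, EM)) (n := ∞))

variable (h : ∀ y, ∃ σ : LocalSection EG G EM p₀, y ∈ σ.baseSet)
  (H : ∀ σ : LocalSection EG G EM p₀, MemTrivializationAtlas (assocTriv D σ))

include h H

/-- The quotient map `G × 𝔪 → G ×_K 𝔪` is smooth. -/
theorem contMDiff_assocQuot :
    ContMDiff (𝓘(ℝ, EG).prod 𝓘(ℝ, D.m)) (𝓘(ℝ, EM).prod 𝓘(ℝ, D.m)) ∞ (assocQuot p₀ D) := by
  intro a
  obtain ⟨σ, hσ⟩ := h (a.1 • p₀)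
  have := H σ
  rw [(assocTriv D σ).contMDiffAt_iff (by exact hσ)]
  have hc := (contMDiff_orbit EG EM p₀).comp (contMDiff_fst (I := 𝓘(ℝ, EG)) (J := 𝓘(ℝ, D.m))
    (M := G) (N := D.m))
  refine ⟨hc a, ?_⟩
  exact (contMDiffOn_assocCoord D σ).contMDiffAt
    ((σ.isOpen_baseSet.preimage hc.continuous).mem_nhds hσ)

/-- A map on `G ×_K 𝔪` is smooth if its composition with `G × 𝔪 → G ×_K 𝔪` is. -/
theorem contMDiff_of_comp_assocQuot {E' H' N : Type*} [NormedAddCommGroup E'] [NormedSpace ℝ E']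
    [TopologicalSpace H'] {I' : ModelWithCorners ℝ E' H'} [TopologicalSpace N] [ChartedSpace H' N]
    {k : TotalSpace D.m (Assoc D) → N}
    (hk : ContMDiff (𝓘(ℝ, EG).prod 𝓘(ℝ, D.m)) I' ∞ (k ∘ assocQuot p₀ D)) :
    ContMDiff (𝓘(ℝ, EM).prod 𝓘(ℝ, D.m)) I' ∞ k := by
  intro z
  obtain ⟨σ, hσ⟩ := h z.1
  have hl : ContMDiffAt (𝓘(ℝ, EM).prod 𝓘(ℝ, D.m)) (𝓘(ℝ, EG).prod 𝓘(ℝ, D.m)) ∞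
      (assocLift D σ) z := (contMDiffOn_assocLift D H σ).contMDiffAt
    ((assocTriv D σ).open_source.mem_nhds hσ)
  have e : k = (k ∘ assocQuot p₀ D) ∘ assocLift D σ := by
    ext z
    simp [assocQuot_assocLift]
  rw [e]
  exact (hk _).comp z hl

omit h in
/-- The quotient map `G × 𝔪 → G ×_K 𝔪` is a submersion. -/
theorem surjective_mfderiv_assocQuot (h : ∀ g : G, ∃ σ : LocalSection EG G EM p₀,
      g • p₀ ∈ σ.baseSet ∧ (σ.toFun (g • p₀) : G) = g) (a : G × D.m) :
    Function.Surjective (mfderiv (𝓘(ℝ, EG).prod 𝓘(ℝ, D.m)) (𝓘(ℝ, EM).prod 𝓘(ℝ, D.m))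
      (assocQuot p₀ D) a) := by
  have h' : ∀ y, ∃ σ : LocalSection EG G EM p₀, y ∈ σ.baseSet := fun y => by
    obtain ⟨g, rfl⟩ := MulAction.exists_smul_eq G p₀ y
    exact ⟨_, (h g).choose_spec.1⟩
  -- The section must pass through `a.1` itself: then the lift sends `[a]` back to `a`, and
  -- differentiating `assocQuot ∘ assocLift = id` there gives a right inverse of the differential at
  -- `a`.
  obtain ⟨σ, hσ, hσg⟩ := h a.1
  have ha := assocLift_assocQuot D σ a hσg
  have hl : MDifferentiableAt (𝓘(ℝ, EM).prod 𝓘(ℝ, D.m)) (𝓘(ℝ, EG).prod 𝓘(ℝ, D.m))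
      (assocLift D σ) (assocQuot p₀ D a) := ((contMDiffOn_assocLift D H σ).contMDiffAt
    ((assocTriv D σ).open_source.mem_nhds hσ)).mdifferentiableAt (by simp)
  have hq : MDifferentiableAt (𝓘(ℝ, EG).prod 𝓘(ℝ, D.m)) (𝓘(ℝ, EM).prod 𝓘(ℝ, D.m))
      (assocQuot p₀ D) a := (contMDiff_assocQuot D h' H).mdifferentiable (by simp) a
  have hq' : HasMFDerivAt (𝓘(ℝ, EG).prod 𝓘(ℝ, D.m)) (𝓘(ℝ, EM).prod 𝓘(ℝ, D.m))
      (assocQuot p₀ D) (assocLift D σ (assocQuot p₀ D a))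
      (mfderiv (𝓘(ℝ, EG).prod 𝓘(ℝ, D.m)) (𝓘(ℝ, EM).prod 𝓘(ℝ, D.m)) (assocQuot p₀ D) a :
        EG × D.m →L[ℝ] EM × D.m) := by
    rw [ha]; exact hq.hasMFDerivAt
  have hc := hq'.comp _ hl.hasMFDerivAt
  have e : assocQuot p₀ D ∘ assocLift D σ = id := by
    ext1 z; exact assocQuot_assocLift D σ z
  rw [e] at hc
  intro w
  exact ⟨_, congrArg (fun L : EM × D.m →L[ℝ] EM × D.m => L w)
    (hasMFDerivAt_unique hc (hasMFDerivAt_id _))⟩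

end Descent

section Theta

variable [IsManifold 𝓘(ℝ, EM) ∞ M] [FiniteDimensional ℝ EM] [SecondCountableTopology G] [T2Space M]

variable (EM) in
/-- The isomorphism `𝔪 ≅ T_{g p₀} M`, `v ↦ d/dt|₀ g exp(t v) p₀`. -/
def orbitEquiv (g : G) : D.m ≃ₗ[ℝ] EM :=
  LinearEquiv.ofBijective ((orbitDeriv EG EM p₀ g : EG →ₗ[ℝ] EM) ∘ₗ D.m.subtype) (by
    constructor
    · rw [injective_iff_map_eq_zero]
      intro v hv
      have h1 : (v : EG) ∈ lieAlg EG (MulAction.stabilizer G p₀) :=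
        (mem_lieAlg_iff_orbitDeriv (EM := EM) g (v : EG)).2 hv
      exact Subtype.ext (Submodule.disjoint_def.1 D.isCompl.disjoint _ h1 v.2)
    · intro w
      obtain ⟨u, rfl⟩ := surjective_orbitDeriv (EG := EG) EM (p₀ := p₀) g w
      obtain ⟨a, ha, b, hb, rfl⟩ := Submodule.mem_sup.1
        (D.isCompl.sup_eq_top ▸ Submodule.mem_top : u ∈ lieAlg EG _ ⊔ D.m)
      refine ⟨⟨b, hb⟩, ?_⟩
      rw [map_add, orbitDeriv_of_mem_lieAlg g ha, zero_add]
      rfl)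

omit [MulAction.IsPretransitive G M] [FiniteDimensional ℝ EG] [IsManifold 𝓘(ℝ, EM) ∞ M]
  [FiniteDimensional ℝ EM] [SecondCountableTopology G] [T2Space M] in
theorem orbitDeriv_projM (g : G) (v : EG) :
    orbitDeriv EG EM p₀ g (D.projM v : EG) = orbitDeriv EG EM p₀ g v := by
  conv_rhs => rw [← D.projK_add_projM v, map_add,
    orbitDeriv_of_mem_lieAlg g (D.projK v).2, zero_add]

variable (EM) in
/-- The isomorphism from the fibre of `G ×_K 𝔪` over `y` to `T_y M`,
`[g, v] ↦ d/dt|₀ g exp(t v) p₀`. -/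
def assocEquiv (y : M) : Assoc D y ≃ₗ[ℝ] EM :=
  (Assoc.frameₗ (Assoc.somePoint p₀ y)).symm.trans
    (orbitEquiv EM D (Assoc.somePoint (G := G) p₀ y : G))

theorem assocEquiv_mk {y : M} (g : OrbitFibre G p₀ y) (v : D.m) :
    assocEquiv EM D y (Assoc.mk g v) = orbitDeriv EG EM p₀ (g : G) (v : EG) := by
  rw [Assoc.mk_eq_mk g (Assoc.somePoint p₀ y) v]
  have h1 : (Assoc.frameₗ (Assoc.somePoint p₀ y)).symm (Assoc.mk (Assoc.somePoint p₀ y)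
      (D.adM (Assoc.diff (Assoc.somePoint p₀ y) g) v))
      = D.adM (Assoc.diff (Assoc.somePoint p₀ y) g) v :=
    (Assoc.frameₗ (D := D) (Assoc.somePoint p₀ y)).symm_apply_apply _
  refine (congrArg (orbitEquiv EM D (Assoc.somePoint (G := G) p₀ y : G)) h1).trans ?_
  refine (orbitDeriv_mul_stabilizer (Assoc.somePoint (G := G) p₀ y : G)
    (Assoc.diff (Assoc.somePoint p₀ y) g).2 (v : EG)).symm.trans ?_
  simp [Assoc.diff]

/-- The `𝔨`-part of `u` acts trivially on the base point, so only its `𝔪`-part is seen. With `u` a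
value of the Maurer--Cartan form this is the formula behind `Ψ = df`. -/
theorem assocEquiv_symm_apply {y : M} (g : OrbitFibre G p₀ y) (u : EG) :
    (assocEquiv EM D y).symm (orbitDeriv EG EM p₀ (g : G) u) = Assoc.mk g (D.projM u) := by
  rw [LinearEquiv.symm_apply_eq, assocEquiv_mk, orbitDeriv_projM]

variable (p₀) in
theorem exists_localSection (g : G) : ∃ σ : LocalSection EG G EM p₀,
    g • p₀ ∈ σ.baseSet ∧ (σ.toFun (g • p₀) : G) = g := by
  obtain ⟨V, s, hV, hgV, hs, hsg, hsy⟩ := exists_orbit_section EG EM p₀ g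
  obtain ⟨σ, rfl, hσs⟩ := LocalSection.exists_of_contMDiffOn hV hs hsy
  exact ⟨σ, hgV, (hσs _ hgV).trans hsg⟩

variable [FiberBundle D.m (Assoc D)] [VectorBundle ℝ D.m (Assoc D)]
  [ContMDiffVectorBundle ∞ D.m (Assoc D) 𝓘(ℝ, EM)]
  (H : ∀ σ : LocalSection EG G EM p₀, MemTrivializationAtlas (assocTriv D σ))

include H

theorem contMDiff_assocEquiv (h : ∀ y, ∃ σ : LocalSection EG G EM p₀, y ∈ σ.baseSet) :
    ContMDiff (𝓘(ℝ, EM).prod 𝓘(ℝ, D.m)) 𝓘(ℝ, EM).tangent ∞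
      (fun z : TotalSpace D.m (Assoc D) =>
        (⟨z.1, assocEquiv EM D z.1 z.2⟩ : TangentBundle 𝓘(ℝ, EM) M)) := by
  refine contMDiff_of_comp_assocQuot D h H ?_
  have h1 := (contMDiff_orbitDeriv EG G EM p₀).comp
    (contMDiff_fst.prodMk (D.m.subtypeL.contDiff.contMDiff.comp contMDiff_snd) :
      ContMDiff (𝓘(ℝ, EG).prod 𝓘(ℝ, D.m)) _ ∞ fun a : G × D.m => (a.1, D.m.subtypeL a.2))
  convert h1 using 1
  ext1 a
  exact congrArg (fun v : EM => (⟨a.1 • p₀, v⟩ : TangentBundle 𝓘(ℝ, EM) M))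
    (assocEquiv_mk D ⟨a.1, rfl⟩ a.2)

/-- For a local section `σ`, differentiating `σ(y) p₀ = y` shows that `w` is `orbitDeriv` at `σ(y)`
of `ω(dσ(w))`. The inverse is therefore `w ↦ [σ(y), pr_𝔪 ω(dσ(w))]`, a composition of smooth maps.
-/
theorem contMDiff_assocEquiv_symm (h : ∀ y, ∃ σ : LocalSection EG G EM p₀, y ∈ σ.baseSet) :
    ContMDiff 𝓘(ℝ, EM).tangent (𝓘(ℝ, EM).prod 𝓘(ℝ, D.m)) ∞
      (fun z : TangentBundle 𝓘(ℝ, EM) M =>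
        (⟨z.1, (assocEquiv EM D z.1).symm z.2⟩ : TotalSpace D.m (Assoc D))) := by
  intro z₀
  obtain ⟨σ, hσ⟩ := h z₀.1
  have hs : ContMDiffOn 𝓘(ℝ, EM).tangent 𝓘(ℝ, EG).tangent ∞
      (tangentMapWithin 𝓘(ℝ, EM) 𝓘(ℝ, EG) (fun y => (σ.toFun y : G)) σ.baseSet)
      (TotalSpace.proj ⁻¹' σ.baseSet) :=
    σ.contMDiffOn.contMDiffOn_tangentMapWithin (by simp) σ.isOpen_baseSet.uniqueMDiffOn
  have hk : ContMDiff 𝓘(ℝ, EG).tangent (𝓘(ℝ, EM).prod 𝓘(ℝ, D.m)) ∞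
      (fun w : TangentBundle 𝓘(ℝ, EG) G =>
        assocQuot p₀ D (w.1, D.projM (maurerCartan w.1 w.2 : EG))) :=
    (contMDiff_assocQuot D h H).comp ((contMDiff_proj _).prodMk
      (D.contMDiff_projM.comp (contMDiff_maurerCartan EG G)))
  have hO : IsOpen ((TotalSpace.proj : TangentBundle 𝓘(ℝ, EM) M → M) ⁻¹' σ.baseSet) :=
    σ.isOpen_baseSet.preimage (contMDiff_proj (n := ∞) (IB := 𝓘(ℝ, EM)) (F := EM)
      (TangentSpace 𝓘(ℝ, EM) : M → Type _)).continuous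
  refine ((hk.comp_contMDiffOn hs).congr fun z hz => ?_).contMDiffAt (hO.mem_nhds hσ)
  have hz' : z.1 ∈ σ.baseSet := hz
  obtain ⟨y, w⟩ := z
  obtain ⟨S, hS⟩ : ∃ S : EM →L[ℝ] EG, HasMFDerivWithinAt 𝓘(ℝ, EM) 𝓘(ℝ, EG)
      (fun y => (σ.toFun y : G)) σ.baseSet y S :=
    ⟨_, ((σ.contMDiffOn y hz').mdifferentiableWithinAt (by simp)).hasMFDerivWithinAt⟩
  have hS' : (mfderivWithin 𝓘(ℝ, EM) 𝓘(ℝ, EG) (fun y => (σ.toFun y : G)) σ.baseSet y :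
      EM →L[ℝ] EG) = S := hS.mfderivWithin (σ.isOpen_baseSet.uniqueMDiffOn y hz')
  have hc := (hasMFDerivAt_orbit (EG := EG) (EM := EM) p₀ (σ.toFun y : G)).comp y
    (hS.hasMFDerivAt (σ.isOpen_baseSet.mem_nhds hz'))
  have e : ((fun g : G => g • p₀) ∘ fun y => (σ.toFun y : G)) = id := by
    ext1 y; exact (σ.toFun y).2
  rw [e] at hc
  have hw : orbitDeriv EG EM p₀ (σ.toFun y : G)
      ((maurerCartan (EG := EG) (σ.toFun y : G) : EG →L[ℝ] EG) (S w)) = (w : EM) :=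
    congrArg (fun L : EM →L[ℝ] EM => L w) (hasMFDerivAt_unique hc (hasMFDerivAt_id _))
  have h1 := assocEquiv_symm_apply (EM := EM) D (σ.toFun y)
    ((maurerCartan (EG := EG) (σ.toFun y : G) : EG →L[ℝ] EG) (S w))
  rw [hw] at h1
  refine (congrArg (TotalSpace.mk (F := D.m) (E := Assoc D) y) h1).trans ?_
  refine (assocMk_eq_assocQuot D _ _).trans ?_
  rw [← hS']
  rfl

end Theta

end AssocSmooth

/-! ### Smooth maps into and out of a pullback bundle. -/

section PullbackBundle

variable {B B' F : Type*} {E : B → Type*} [∀ x, AddCommMonoid (E x)]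
  [NormedAddCommGroup F] [NormedSpace ℝ F] [TopologicalSpace (TotalSpace F E)]
  [∀ x, TopologicalSpace (E x)]
  {EB : Type*} [NormedAddCommGroup EB] [NormedSpace ℝ EB] [TopologicalSpace B] [ChartedSpace EB B]
  {EB' : Type*} [NormedAddCommGroup EB'] [NormedSpace ℝ EB'] [TopologicalSpace B']
  [ChartedSpace EB' B'] [FiberBundle F E] (f : C^∞⟮𝓘(ℝ, EB'), B'; 𝓘(ℝ, EB), B⟯)

/-- The trivialization of the pullback at a point is pulled back from that of the bundle at its
image, so the fibre coordinates agree and only the base component needs an argument. -/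
theorem contMDiff_pullbackLift :
    ContMDiff (𝓘(ℝ, EB').prod 𝓘(ℝ, F)) (𝓘(ℝ, EB).prod 𝓘(ℝ, F)) ∞
      (Pullback.lift f : TotalSpace F (f *ᵖ E) → TotalSpace F E) := by
  intro z
  rw [contMDiffAt_totalSpace]
  refine ⟨(f.contMDiff.comp (contMDiff_proj (f *ᵖ E))) z, ?_⟩
  exact (contMDiffAt_totalSpace.1 (contMDiffAt_id (M := TotalSpace F (f *ᵖ E))
    (I := 𝓘(ℝ, EB').prod 𝓘(ℝ, F)) (n := ∞) (x := z))).2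

theorem contMDiff_of_pullbackLift {EN HN N : Type*} [NormedAddCommGroup EN] [NormedSpace ℝ EN]
    [TopologicalSpace HN] {I : ModelWithCorners ℝ EN HN} [TopologicalSpace N] [ChartedSpace HN N]
    {k : N → TotalSpace F (f *ᵖ E)} (h1 : ContMDiff I 𝓘(ℝ, EB') ∞ fun n => (k n).1)
    (h2 : ContMDiff I (𝓘(ℝ, EB).prod 𝓘(ℝ, F)) ∞
      fun n => (⟨f (k n).1, (k n).2⟩ : TotalSpace F E)) :
    ContMDiff I (𝓘(ℝ, EB').prod 𝓘(ℝ, F)) ∞ k := by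
  intro n
  rw [contMDiffAt_totalSpace]
  exact ⟨h1 n, (contMDiffAt_totalSpace.1 (h2 n)).2⟩

end PullbackBundle

/-! ### Smoothness of deck transformations. -/

section Deck

variable {EX : Type*} [NormedAddCommGroup EX] [NormedSpace ℝ EX]
  {X : Type*} [TopologicalSpace X] [ChartedSpace EX X]
  {Xt : Type*} [TopologicalSpace Xt] [ChartedSpace EX Xt]
  {Γ : Type*} [Group Γ] [MulAction Γ Xt]

/-- Deck transformations are smooth. -/
theorem contMDiff_deck {p : Xt → X} (hp : IsQuotientCoveringMap p Γ)
    (hp' : IsLocalDiffeomorph 𝓘(ℝ, EX) 𝓘(ℝ, EX) ∞ p) (c : Γ) :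
    ContMDiff 𝓘(ℝ, EX) 𝓘(ℝ, EX) ∞ (fun x : Xt => c • x) := by
  intro x
  obtain ⟨φ, hx, hφ⟩ := hp' (c • x)
  have hc : Continuous fun x : Xt => c • x := hp.continuous_const_smul c
  have hpc : ∀ y, p (c • y) = p y := fun y => hp.apply_eq_iff_mem_orbit.2 ⟨c, rfl⟩
  -- Since `p (c • y) = p y`, near `x` the map `c` is `p` followed by the local inverse of `p`
  -- around `c • x`.
  have h1 : ContMDiffAt 𝓘(ℝ, EX) 𝓘(ℝ, EX) ∞ (φ.symm ∘ p) x := by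
    refine ContMDiffAt.comp x ?_ (hp'.contMDiff x)
    refine φ.contMDiffOn_invFun.contMDiffAt (φ.open_target.mem_nhds ?_)
    rw [← hpc x, hφ hx]
    exact φ.map_source hx
  refine h1.congr_of_eventuallyEq ?_
  filter_upwards [(φ.open_source.preimage hc).mem_nhds hx] with y hy
  change c • y = φ.symm (p y)
  rw [← hpc y, hφ hy]
  exact (φ.left_inv hy).symm

end Deck

/-! ### The reduction `E_K`, its connection, and the one-form `Ψ`. -/

section Reduction

open Set Filter Topology

variable {EX : Type*} [NormedAddCommGroup EX] [NormedSpace ℝ EX]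
  {Xt : Type*} [TopologicalSpace Xt] [ChartedSpace EX Xt] [IsManifold 𝓘(ℝ, EX) ∞ Xt]
  {EG : Type*} [NormedAddCommGroup EG] [NormedSpace ℝ EG]
  {G : Type*} [TopologicalSpace G] [ChartedSpace EG G] [Group G] [LieGroup 𝓘(ℝ, EG) ∞ G]
  {EM : Type*} [NormedAddCommGroup EM] [NormedSpace ℝ EM]
  {M : Type*} [TopologicalSpace M] [ChartedSpace EM M] [MulAction G M]
  [ContMDiffSMul 𝓘(ℝ, EG) 𝓘(ℝ, EM) ∞ G M] {p₀ : M}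

-- Differentiate the defining equation `b t • p₀ = f (a t)` of curves in `E_K` at `t = 0`.
omit [IsManifold 𝓘(ℝ, EX) ∞ Xt] in
theorem IsTangentEK.orbitDeriv_maurerCartan {f : Xt → M}
    (hf : ContMDiff 𝓘(ℝ, EX) 𝓘(ℝ, EM) ∞ f) {x : Xt} {g : G}
    {w : TangentSpace 𝓘(ℝ, EX) x × TangentSpace 𝓘(ℝ, EG) g} (hw : IsTangentEK p₀ f x g w) :
    orbitDeriv EG EM p₀ g (maurerCartan g w.2)
      = (mfderiv 𝓘(ℝ, EX) 𝓘(ℝ, EM) f x w.1 : EM) := by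
  obtain ⟨u, v⟩ := w
  obtain ⟨a, b, hab, ⟨ha, rfl, rfl⟩, ⟨hb, rfl, rfl⟩⟩ := hw
  have h1 := (hasMFDerivAt_orbit (EG := EG) (EM := EM) p₀ (b 0)).comp (0 : ℝ)
    ((hb.mdifferentiable (by simp)) 0).hasMFDerivAt
  have h2 := ((hf.mdifferentiable (by simp)) (a 0)).hasMFDerivAt.comp (0 : ℝ)
    ((ha.mdifferentiable (by simp)) 0).hasMFDerivAt
  have e : (fun g : G => g • p₀) ∘ b = f ∘ a := by
    ext1 t; exact hab t
  rw [e] at h1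
  exact congrArg (fun L : ℝ →L[ℝ] EM => L 1) (hasMFDerivAt_unique h1 h2)

/-- Every tangent vector of the base lifts to a tangent vector of `E_K`. -/
theorem exists_isTangentEK [IsManifold 𝓘(ℝ, EM) ∞ M] [FiniteDimensional ℝ EG]
    [FiniteDimensional ℝ EM] [SecondCountableTopology G] [T2Space M]
    [MulAction.IsPretransitive G M] {f : Xt → M}
    (hf : ContMDiff 𝓘(ℝ, EX) 𝓘(ℝ, EM) ∞ f) (x : Xt) (g : G) (hg : g • p₀ = f x)
    (u : TangentSpace 𝓘(ℝ, EX) x) :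
    ∃ v : TangentSpace 𝓘(ℝ, EG) g, IsTangentEK p₀ f x g (u, v) := by
  obtain ⟨V, s, hV, hgV, hs, hsg, hsy⟩ := exists_orbit_section EG EM p₀ g
  let U : Set EX := (extChartAt 𝓘(ℝ, EX) x).target ∩
    (extChartAt 𝓘(ℝ, EX) x).symm ⁻¹' (f ⁻¹' V)
  have hU : IsOpen U := (continuousOn_extChartAt_symm x).isOpen_inter_preimage
    (isOpen_extChartAt_target x) (hV.preimage hf.continuous)
  let u' : EX := u
  -- A straight line in the chart with velocity `u`, reparametrized to stay where `f` takes values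
  -- in `V`. The second component of the curve in `E_K` is then `s ∘ f ∘ a`, which starts at `g`
  -- because the section `s` passes through `g`.
  let c : ℝ → EX := fun t => extChartAt 𝓘(ℝ, EX) x x + t • u'
  have hcs : ContDiff ℝ ∞ c := contDiff_const.add (contDiff_id.smul contDiff_const)
  have hc0 : c 0 = extChartAt 𝓘(ℝ, EX) x x := by
    change _ + (0 : ℝ) • u' = _
    rw [zero_smul, add_zero]
  have hcd : HasDerivAt c u' 0 := by
    have h := ((hasDerivAt_id (0 : ℝ)).smul_const u').const_add (extChartAt 𝓘(ℝ, EX) x x)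
    rw [one_smul] at h
    exact h
  have hxU : c 0 ∈ U := by
    rw [hc0]
    refine ⟨mem_extChartAt_target x, ?_⟩
    change f _ ∈ V
    rw [extChartAt_to_inv, ← hg]
    exact hgV
  obtain ⟨δ, hδ, hδU⟩ := Metric.mem_nhds_iff.1 ((hU.preimage hcs.continuous).mem_nhds hxU)
  obtain ⟨a, ha, hat⟩ := exists_isCurveWithVelocity (N := Xt) hc0 hδ hcs.contDiffOn
    (fun t ht => hδU ht) hcd ((contMDiffOn_extChartAt_symm x).mono inter_subset_left)
    (hasMFDerivAt_extChartAt_symm_self Xt x)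
  rw [extChartAt_to_inv] at ha
  have haV : ∀ t, f (a t) ∈ V := fun t => by
    obtain ⟨τ, hτ, h⟩ := hat t
    rw [h]
    exact (hδU hτ).2
  have hb : ContMDiff 𝓘(ℝ) 𝓘(ℝ, EG) ∞ (s ∘ f ∘ a) := by
    rw [← contMDiffOn_univ]
    exact hs.comp (hf.comp ha.1).contMDiffOn fun t _ => haV t
  have hb0 : (s ∘ f ∘ a) 0 = g := by
    change s (f (a 0)) = g
    rw [ha.2.1, ← hg, hsg]
  exact ⟨(mfderiv 𝓘(ℝ) 𝓘(ℝ, EG) (s ∘ f ∘ a) 0 (1 : ℝ) : EG), a, s ∘ f ∘ a,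
    fun t => hsy _ (haV t), ha, hb, hb0, rfl⟩

variable [FiniteDimensional ℝ EG] (D : CartanDecomposition EG (MulAction.stabilizer G p₀))

omit [TopologicalSpace M] in
/-- The `𝔨`-part of the flat connection is a connection on `E_K`. -/
theorem isKConnection_kForm (f : Xt → M) : IsKConnection (EX := EX) p₀ f (kForm D) where
  smooth := by
    have h : ContMDiff 𝓘(ℝ, EG) 𝓘(ℝ, lieAlg EG (MulAction.stabilizer G p₀)) ∞ D.projK :=
      (LinearMap.toContinuousLinearMap D.projK).contDiff.contMDiff
    exact h.comp ((contMDiff_maurerCartan EG G).comp contMDiff_snd)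
  vertical x g _ ξ := by
    refine (congrArg D.projK (maurerCartan_leftDeriv g (ξ : EG))).trans ?_
    exact Submodule.projectionOnto_apply_left D.isCompl ξ
  equivariant x g _ k hk w _ := by
    refine (congrArg (fun v : EG => (D.projK v : EG))
      (maurerCartan_mul_right (EG := EG) g k w.2)).trans ?_
    exact D.projK_Ad ((MulAction.stabilizer G p₀).inv_mem hk) _

variable [IsManifold 𝓘(ℝ, EM) ∞ M] [FiniteDimensional ℝ EM] [SecondCountableTopology G]
  [T2Space M] [MulAction.IsPretransitive G M]

/-- The isomorphism `G ×_K 𝔪 ≅ TM` is equivariant. -/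
theorem assocEquiv_translate (a : G) {y y' : M} (h : y' = a • y) (z : Assoc D y) :
    assocEquiv EM D y' (Assoc.translate a h z)
      = (mfderiv 𝓘(ℝ, EM) 𝓘(ℝ, EM) (fun y : M => a • y) y (assocEquiv EM D y z : EM) : EM) := by
  obtain ⟨g, v⟩ := z
  have h1 := assocEquiv_mk (EM := EM) D g v
  have h2 := assocEquiv_mk (EM := EM) D (y := y') ⟨a * g, by rw [mul_smul, g.2, h]⟩ v
  have h3 := mfderiv_smul_orbitDeriv (EM := EM) (EG := EG) a (g : G) g.2.symm (v : EG)
  exact h2.trans (h3.symm.trans (congrArg (fun w : EM =>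
    (mfderiv 𝓘(ℝ, EM) 𝓘(ℝ, EM) (fun y : M => a • y) y w : EM)) h1.symm))

variable (EM) in
/-- The one-form with values in `f^*(G ×_K 𝔪)` that corresponds to the differential of `f`. -/
def assocForm (f : Xt → M) (x : Xt) : TangentSpace 𝓘(ℝ, EX) x →ₗ[ℝ] (f *ᵖ (Assoc D)) x :=
  (assocEquiv EM D (f x)).symm.toLinearMap ∘ₗ (mfderiv 𝓘(ℝ, EX) 𝓘(ℝ, EM) f x).toLinearMap

/-- The form `Φ⁻¹ ∘ df` has the required values by `assocEquiv_symm_apply`. It is the only one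
because every tangent vector of the base lifts to `E_K`, so that the condition fixes all values. -/
theorem isMPart_iff {f : Xt → M} (hf : ContMDiff 𝓘(ℝ, EX) 𝓘(ℝ, EM) ∞ f)
    (Ψ : ∀ x : Xt, TangentSpace 𝓘(ℝ, EX) x →ₗ[ℝ] (f *ᵖ (Assoc D)) x) :
    IsMPart D f Ψ ↔ Ψ = assocForm (EX := EX) EM D f := by
  have key : IsMPart D f (assocForm (EX := EX) EM D f) := by
    intro x g w hw
    have h1 := assocEquiv_symm_apply (EM := EM) D g (maurerCartan (g : G) w.2 : EG)
    rw [hw.orbitDeriv_maurerCartan hf] at h1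
    exact h1
  constructor
  · intro hΨ
    funext x
    ext u
    obtain ⟨v, hv⟩ := exists_isTangentEK (EG := EG) (EM := EM) hf x
      (Assoc.somePoint (G := G) p₀ (f x) : G) (Assoc.somePoint p₀ (f x)).2 u
    exact (hΨ x (Assoc.somePoint p₀ (f x)) (u, v) hv).trans
      (key x (Assoc.somePoint p₀ (f x)) (u, v) hv).symm
  · rintro rfl
    exact key

omit [IsManifold 𝓘(ℝ, EX) ∞ Xt] in
theorem assocEquiv_assocForm (f : Xt → M) (x : Xt) (u : TangentSpace 𝓘(ℝ, EX) x) :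
    assocEquiv EM D (f x) (assocForm EM D f x u) = (mfderiv 𝓘(ℝ, EX) 𝓘(ℝ, EM) f x u : EM) :=
  LinearEquiv.apply_symm_apply (assocEquiv EM D (f x)) (mfderiv 𝓘(ℝ, EX) 𝓘(ℝ, EM) f x u : EM)

-- Under the equivariant isomorphism with `TM` this becomes the differential of `a • f = f ∘ φ`.
omit [IsManifold 𝓘(ℝ, EX) ∞ Xt] in
theorem translate_assocForm {f : Xt → M} (hf : MDifferentiable 𝓘(ℝ, EX) 𝓘(ℝ, EM) f) {φ : Xt → Xt}
    (hφ : MDifferentiable 𝓘(ℝ, EX) 𝓘(ℝ, EX) φ) (a : G) (h : ∀ x, f (φ x) = a • f x) (x : Xt)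
    (u : TangentSpace 𝓘(ℝ, EX) x) :
    (Assoc.translate a (h x) (assocForm EM D f x u) : Assoc D (f (φ x)))
      = assocForm EM D f (φ x) (mfderiv 𝓘(ℝ, EX) 𝓘(ℝ, EX) φ x u) := by
  apply (assocEquiv EM D (f (φ x))).injective
  refine (assocEquiv_translate D a (h x) _).trans ?_
  refine Eq.trans ?_ (assocEquiv_assocForm D f (φ x) _).symm
  have h1 := ((mdifferentiable_const_smul EG a) (f x)).hasMFDerivAt.comp x (hf x).hasMFDerivAt
  have h2 := (hf (φ x)).hasMFDerivAt.comp x (hφ x).hasMFDerivAt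
  have e : (fun y : M => a • y) ∘ f = f ∘ φ := by
    ext1 x; exact (h x).symm
  rw [e] at h1
  refine (congrArg (fun w : EM => (mfderiv 𝓘(ℝ, EM) 𝓘(ℝ, EM) (fun y : M => a • y) (f x) w : EM))
    (assocEquiv_assocForm D f x u)).trans ?_
  exact congrArg (fun L : EX →L[ℝ] EM => L u) (hasMFDerivAt_unique h1 h2)

end Reduction

end

end SymBundle

/-! ### The main theorem. -/

theorem mainTheorem1
    -- the Lie group `G`
    {EG : Type*} [NormedAddCommGroup EG] [NormedSpace ℝ EG] [FiniteDimensional ℝ EG]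
    {G : Type*} [TopologicalSpace G] [T2Space G] [SecondCountableTopology G]
    [ChartedSpace EG G] [Group G] [LieGroup 𝓘(ℝ, EG) ∞ G]
    -- the model `M` of `G/K`, where `K` is the stabilizer of `p₀`
    {EM : Type*} [NormedAddCommGroup EM] [NormedSpace ℝ EM] [FiniteDimensional ℝ EM]
    {M : Type*} [TopologicalSpace M] [T2Space M] [ChartedSpace EM M] [IsManifold 𝓘(ℝ, EM) ∞ M]
    [MulAction G M] [ContMDiffSMul 𝓘(ℝ, EG) 𝓘(ℝ, EM) ∞ G M] [MulAction.IsPretransitive G M]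
    (p₀ : M)
    -- the Cartan decomposition `𝔤 = 𝔨 ⊕ 𝔪`
    (D : SymBundle.CartanDecomposition EG (MulAction.stabilizer G p₀))
    -- the manifold `X`, its universal covering `p : Xt → X`, with deck transformation group `Γ`
    {EX : Type*} [NormedAddCommGroup EX] [NormedSpace ℝ EX] [FiniteDimensional ℝ EX]
    {X : Type*} [TopologicalSpace X] [ChartedSpace EX X] [IsManifold 𝓘(ℝ, EX) ∞ X]
    {Xt : Type*} [TopologicalSpace Xt] [ChartedSpace EX Xt] [IsManifold 𝓘(ℝ, EX) ∞ Xt]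
    [SimplyConnectedSpace Xt] {Γ : Type*} [Group Γ] [MulAction Γ Xt]
    (p : Xt → X) (hp : IsQuotientCoveringMap p Γ)
    (hp' : IsLocalDiffeomorph 𝓘(ℝ, EX) 𝓘(ℝ, EX) ∞ p) (x₀ : Xt)
    -- the representation `ρ` and the `ρ`-equivariant map `f`
    (ρ : FundamentalGroup X (p x₀) →* G) (f : C^∞⟮𝓘(ℝ, EX), Xt; 𝓘(ℝ, EM), M⟯)
    (hf : ∀ (c : FundamentalGroup X (p x₀)) (x : Xt),
      f (SymBundle.deck hp x₀ c • x) = ρ c • f x) :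
    -- `G ×_K 𝔪` is a smooth vector bundle over `M`, with the smooth structure for which
    -- `G × 𝔪 → G ×_K 𝔪` is a submersion; so `E_K(𝔪) = f^*(G ×_K 𝔪)` is a smooth vector bundle
    ∃ (_ : FiberBundle D.m (SymBundle.Assoc D)) (_ : VectorBundle ℝ D.m (SymBundle.Assoc D))
      (_ : ContMDiffVectorBundle ∞ D.m (SymBundle.Assoc D) 𝓘(ℝ, EM)),
      ContMDiff (𝓘(ℝ, EG).prod 𝓘(ℝ, D.m)) (𝓘(ℝ, EM).prod 𝓘(ℝ, D.m)) ∞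
        (SymBundle.assocQuot p₀ D) ∧
      (∀ a : G × D.m, Function.Surjective (mfderiv (𝓘(ℝ, EG).prod 𝓘(ℝ, D.m))
        (𝓘(ℝ, EM).prod 𝓘(ℝ, D.m)) (SymBundle.assocQuot p₀ D) a)) ∧
      -- the decomposition `∇ = D + Ψ`, where `D` is a `π₁(X)`-invariant connection on `E_K`
      (∀ (x : Xt) (g : G) (w : TangentSpace 𝓘(ℝ, EX) x × TangentSpace 𝓘(ℝ, EG) g),
        SymBundle.flatForm x g w
          = (SymBundle.kForm D x g w : EG) + (SymBundle.mForm D x g w : EG)) ∧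
      SymBundle.IsKConnection (EX := EX) p₀ f (SymBundle.kForm D) ∧
      (∀ (c : FundamentalGroup X (p x₀)) (x : Xt) (g : G)
        (w : TangentSpace 𝓘(ℝ, EX) x × TangentSpace 𝓘(ℝ, EG) g),
        SymBundle.kForm D (SymBundle.deck hp x₀ c • x) (ρ c * g)
          (mfderiv 𝓘(ℝ, EX) 𝓘(ℝ, EX) (fun y : Xt => SymBundle.deck hp x₀ c • y) x w.1,
            mfderiv 𝓘(ℝ, EG) 𝓘(ℝ, EG) (fun h : G => ρ c * h) g w.2)
          = SymBundle.kForm D x g w) ∧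
      -- the identification `Φ : E_K(𝔪) ≅ f^* TM`
      ∃ Φ : ∀ x : Xt, (f *ᵖ (SymBundle.Assoc D)) x ≃ₗ[ℝ]
          (f *ᵖ (TangentSpace 𝓘(ℝ, EM) : M → Type _)) x,
        -- it is an isomorphism of smooth vector bundles
        ContMDiff (𝓘(ℝ, EX).prod 𝓘(ℝ, D.m)) (𝓘(ℝ, EX).prod 𝓘(ℝ, EM)) ∞
          (fun z : TotalSpace D.m (f *ᵖ (SymBundle.Assoc D)) =>
            (⟨z.1, Φ z.1 z.2⟩ : TotalSpace EM (f *ᵖ (TangentSpace 𝓘(ℝ, EM) : M → Type _)))) ∧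
        ContMDiff (𝓘(ℝ, EX).prod 𝓘(ℝ, EM)) (𝓘(ℝ, EX).prod 𝓘(ℝ, D.m)) ∞
          (fun z : TotalSpace EM (f *ᵖ (TangentSpace 𝓘(ℝ, EM) : M → Type _)) =>
            (⟨z.1, (Φ z.1).symm z.2⟩ : TotalSpace D.m (f *ᵖ (SymBundle.Assoc D)))) ∧
        -- it is the canonical one: `[g, v]` goes to the velocity at `t = 0` of `g exp(t v) p₀`
        (∀ (x : Xt) (g : SymBundle.OrbitFibre G p₀ (f x)) (v : D.m),
          Φ x (SymBundle.Assoc.mk g v)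
            = (mfderiv 𝓘(ℝ, EG) 𝓘(ℝ, EM) (fun h : G => ((g : G) * h) • p₀) 1 (v : EG) : EM)) ∧
        -- it is equivariant under `π₁(X)`
        (∀ (c : FundamentalGroup X (p x₀)) (z : TotalSpace D.m (f *ᵖ (SymBundle.Assoc D))),
          (fun y : TotalSpace D.m (f *ᵖ (SymBundle.Assoc D)) =>
            (⟨y.1, Φ y.1 y.2⟩ : TotalSpace EM (f *ᵖ (TangentSpace 𝓘(ℝ, EM) : M → Type _))))
              (SymBundle.actAssoc D f (fun x => SymBundle.deck hp x₀ c • x) (ρ c) (hf c) z)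
            = SymBundle.actTangent f (fun x => SymBundle.deck hp x₀ c • x) (ρ c)
                ⟨z.1, Φ z.1 z.2⟩) ∧
        -- the `𝔪`-part of `∇` is a well-defined smooth `π₁(X)`-invariant one-form `Ψ` with values
        -- in `E_K(𝔪)`, and `Φ` takes it to `df`
        ∃ Ψ : ∀ x : Xt, TangentSpace 𝓘(ℝ, EX) x →ₗ[ℝ] (f *ᵖ (SymBundle.Assoc D)) x,
          (∀ Ψ', SymBundle.IsMPart D f Ψ' ↔ Ψ' = Ψ) ∧
          ContMDiff 𝓘(ℝ, EX).tangent (𝓘(ℝ, EX).prod 𝓘(ℝ, D.m)) ∞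
            (fun z : TangentBundle 𝓘(ℝ, EX) Xt =>
              (⟨z.1, Ψ z.1 z.2⟩ : TotalSpace D.m (f *ᵖ (SymBundle.Assoc D)))) ∧
          (∀ (c : FundamentalGroup X (p x₀)) (x : Xt) (u : TangentSpace 𝓘(ℝ, EX) x),
            SymBundle.actAssoc D f (fun x => SymBundle.deck hp x₀ c • x) (ρ c) (hf c) ⟨x, Ψ x u⟩
              = ⟨SymBundle.deck hp x₀ c • x, Ψ (SymBundle.deck hp x₀ c • x)
                  (mfderiv 𝓘(ℝ, EX) 𝓘(ℝ, EX)
                    (fun y : Xt => SymBundle.deck hp x₀ c • y) x u)⟩) ∧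
          ∀ (x : Xt) (u : TangentSpace 𝓘(ℝ, EX) x),
            Φ x (Ψ x u) = mfderiv 𝓘(ℝ, EX) 𝓘(ℝ, EM) f x u := by
  have hloc := SymBundle.exists_localSection (EG := EG) (EM := EM) (G := G) p₀
  have h : ∀ y, ∃ σ : SymBundle.LocalSection EG G EM p₀, y ∈ σ.baseSet := fun y => by
    obtain ⟨g, rfl⟩ := MulAction.exists_smul_eq G p₀ y
    exact ⟨_, (hloc g).choose_spec.1⟩
  obtain ⟨_, _, _, H⟩ := SymBundle.exists_assoc_contMDiffVectorBundle EM D h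
  have hpd := fun c : FundamentalGroup X (p x₀) =>
    (SymBundle.contMDiff_deck hp hp' (SymBundle.deck hp x₀ c)).mdifferentiable (n := ∞) (by simp)
  -- `Ψ` is the tangent map of `f` followed by the inverse of `G ×_K 𝔪 ≅ TM`, both smooth.
  have hΨ : ContMDiff 𝓘(ℝ, EX).tangent (𝓘(ℝ, EM).prod 𝓘(ℝ, D.m)) ∞
      (fun z : TangentBundle 𝓘(ℝ, EX) Xt =>
        (⟨f z.1, SymBundle.assocForm EM D f z.1 z.2⟩ : TotalSpace D.m (SymBundle.Assoc D))) :=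
    (SymBundle.contMDiff_assocEquiv_symm D H h).comp
      (f.contMDiff.contMDiff_tangentMap (m := ∞) (by simp))
  refine ⟨inferInstance, inferInstance, inferInstance, SymBundle.contMDiff_assocQuot D h H,
    SymBundle.surjective_mfderiv_assocQuot D H hloc,
    fun x g w => (D.projK_add_projM _).symm, SymBundle.isKConnection_kForm D f,
    fun c x g w => congrArg D.projK (SymBundle.maurerCartan_mul_left (EG := EG) (ρ c) g w.2),
    fun x => SymBundle.assocEquiv EM D (f x), ?_, ?_, ?_, ?_, SymBundle.assocForm EM D f,
    SymBundle.isMPart_iff D f.contMDiff, ?_, ?_, ?_⟩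
  · exact SymBundle.contMDiff_of_pullbackLift f (contMDiff_proj _)
      ((SymBundle.contMDiff_assocEquiv D H h).comp (SymBundle.contMDiff_pullbackLift f))
  · exact SymBundle.contMDiff_of_pullbackLift f (contMDiff_proj _)
      ((SymBundle.contMDiff_assocEquiv_symm D H h).comp (SymBundle.contMDiff_pullbackLift f))
  · exact fun x g v => SymBundle.assocEquiv_mk (EM := EM) D g v
  · exact fun c z => congrArg (fun w : EM => (⟨SymBundle.deck hp x₀ c • z.1, w⟩ :
      TotalSpace EM (f *ᵖ (TangentSpace 𝓘(ℝ, EM) : M → Type _))))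
      (SymBundle.assocEquiv_translate D (ρ c) (hf c z.1) z.2)
  · exact SymBundle.contMDiff_of_pullbackLift f (contMDiff_proj _) hΨ
  · exact fun c x u => congrArg (TotalSpace.mk (F := D.m) (E := f *ᵖ (SymBundle.Assoc D))
      (SymBundle.deck hp x₀ c • x)) (SymBundle.translate_assocForm D
        (f.contMDiff.mdifferentiable (by simp)) (hpd c) (ρ c) (hf c) x u)
  · exact fun x u => SymBundle.assocEquiv_assocForm (EM := EM) D f x u
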